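/- Let $\ell>0$ and $\nu=\pi/\ell$. For $\alpha\in\mathbb R_+ = [0,+\infty[$ let $T_\alpha=-\frac{d^2}{dy^2}$ be the operator on $L^2(0,\ell)$ with domain \[ \mathrm{Dom}(T_\alpha)=\{u\in H^2(0,\ell):\ u'(0)=-i\alpha u(0),\ u'(\ell)=i\alpha u(\ell)\}. \] There is a unique family of continuous functions $\theta_n:\mathbb R_+\to\mathbb C$, $n\in\mathbb N=\{0,1,2,\dots\}$, such that $\theta_n(0)=n\nu$ and, for every $\alpha\ge 0$, $\mathrm{Re}\,\theta_n(\alpha)\ge 0$ and $\theta_n(\alpha)^2$ is an eigenvalue of $T_\alpha$. For every $\alpha\ge0$ the numbers $\theta_n(\alpha)^2$, $n\in\mathbb N$, are pairwise distinct and are exactly the eigenvalues of $T_\alpha$, and \[ (\alpha-\theta_n(\alpha))^2e^{2i\ell\theta_n(\alpha)}=(\alpha+\theta_n(\alpha))^2 . \] Moreover: \begin{enumerate} \item[(i)] For every $n\in\mathbb N$ the map $\alpha\mapsto\mathrm{Re}\,\theta_n(\alpha)$ is strictly increasing on $\mathbb R_+$, equals $n\nu$ at $\alpha=0$ and tends to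 $(n+1)\nu$ as $\alpha\to+\infty$. \item[(ii)] For every $n\in\mathbb N$, $\mathrm{Im}\,\theta_n(\alpha)\to0$ as $\alpha\to+\infty$. \item[(iii)] $\sup_{\alpha\in\mathbb R_+}|\mathrm{Im}\,\theta_n(\alpha)|$ is finite for every $n\in\mathbb N$ and is $O(\ln n)$ as $n\to\infty$. \item[(iv)] For every $\beta\in\mathbb R$, as $n\to\infty$, \[ \mathrm{Re}\,\theta_n(n\nu+\beta\ln n)-n\nu\longrightarrow\nu\Big(1-\frac{\arg(\beta+i/\ell)}{\pi}\Big),\qquad -\mathrm{Im}\,\theta_n(n\nu+\beta\ln n)\sim\frac{\ln n}{\ell}, \] where $\arg(\beta+i/\ell)\in\,]0,\pi[$. \item[(v)] For every $\gamma>0$ with $\gamma\ne1$, as $n\to\infty$, \[ -\mathrm{Im}\,\theta_n(\gamma n\nu)\longrightarrow\frac1\ell\ln\Big|\frac{1+\gamma}{1-\gamma}\Big|,\qquad \mathrm{Re}\,\theta_n(\gamma n\nu)-n\nu\longrightarrow\begin{cases}0&\text{if }\gamma<1,\\ \nu&\text{if }\gamma>1.\end{cases} \] \item[(vi)] For every $\rho\in\,]0,1[$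 and $s\in\mathbb R\setminus\{0\}$, as $n\to\infty$, \[ -\mathrm{Im}\,\theta_n(n\nu+sn^\rho)\sim\frac{1-\rho}{\ell}\ln n,\qquad \mathrm{Re}\,\theta_n(n\nu+sn^\rho)-n\nu\longrightarrow\begin{cases}0&\text{if }s<0,\\ \nu&\text{if }s>0.\end{cases} \] \end{enumerate} -/

import Mathlib

open MeasureTheory Set Filter Topology
open scoped ContDiff

/-- `v` is the weak derivative of `u` on the interval `]0, ℓ[`:
`∫ u φ' = - ∫ v φ` for all test functions `φ ∈ C_c^∞(]0, ℓ[)`. -/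
def HasWeakDeriv (ℓ : ℝ) (u v : ℝ → ℂ) : Prop :=
  ∀ φ : ℝ → ℝ, ContDiff ℝ ∞ φ → HasCompactSupport φ → tsupport φ ⊆ Ioo 0 ℓ →
    ∫ y in Ioo 0 ℓ, deriv φ y • u y = - ∫ y in Ioo 0 ℓ, φ y • v y

/-- `u ∈ H²(0, ℓ)`, with first and second weak derivatives `u₁` and `u₂`. -/
structure IsH2 (ℓ : ℝ) (u u₁ u₂ : ℝ → ℂ) : Prop where
  memLp_zero : MemLp u 2 (volume.restrict (Ioo 0 ℓ))
  memLp_one : MemLp u₁ 2 (volume.restrict (Ioo 0 ℓ))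
  memLp_two : MemLp u₂ 2 (volume.restrict (Ioo 0 ℓ))
  weakDeriv_one : HasWeakDeriv ℓ u u₁
  weakDeriv_two : HasWeakDeriv ℓ u₁ u₂

/-- `u` belongs to the domain of `T_α`, with weak derivatives `u₁ = u'` and `u₂ = u''`:
`u ∈ H²(0, ℓ)` with `u'(0) = - i α u(0)` and `u'(ℓ) = i α u(ℓ)`. The boundary values are those of
the representatives of `u` and `u'` which are continuous on `[0, ℓ]`. -/
structure MemDomT (ℓ : ℝ) (α : ℂ) (u u₁ u₂ : ℝ → ℂ) : Prop where
  isH2 : IsH2 ℓ u u₁ u₂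
  continuousOn_zero : ContinuousOn u (Icc 0 ℓ)
  continuousOn_one : ContinuousOn u₁ (Icc 0 ℓ)
  boundary_left : u₁ 0 = -(Complex.I * α * u 0)
  boundary_right : u₁ ℓ = Complex.I * α * u ℓ

/-- `μ` is an eigenvalue of the operator `T_α = - d²/dy²` on `L²(0, ℓ)`: there is a nonzero `u` in
the domain of `T_α` with `- u'' = μ u` in `L²(0, ℓ)`. -/
def IsEigenvalueT (ℓ : ℝ) (α μ : ℂ) : Prop :=
  ∃ u u₁ u₂ : ℝ → ℂ, MemDomT ℓ α u u₁ u₂ ∧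
    ¬ (u =ᵐ[volume.restrict (Ioo 0 ℓ)] 0) ∧
    (fun y => - u₂ y) =ᵐ[volume.restrict (Ioo 0 ℓ)] fun y => μ * u y

/-- `θ` is the family of square roots of the eigenvalues of `T_α`, `α ≥ 0`, followed continuously
from the Neumann case `α = 0`. Only the values `θ n α` for `α ≥ 0` are relevant. -/
structure IsEigenBranches (ℓ : ℝ) (θ : ℕ → ℝ → ℂ) : Prop where
  continuousOn : ∀ n, ContinuousOn (θ n) (Ici 0)
  at_zero : ∀ n, θ n 0 = ((n * (Real.pi / ℓ) : ℝ) : ℂ)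
  eigenvalue : ∀ n, ∀ α : ℝ, 0 ≤ α → IsEigenvalueT ℓ α (θ n α ^ 2)
  re_nonneg : ∀ n, ∀ α : ℝ, 0 ≤ α → 0 ≤ (θ n α).re

/-! An eigenfunction is classical: its weak derivatives are continuous, so the du Bois-Reymond lemma
applies. It therefore combines `e^{iθy}` and `e^{-iθy}`, and the boundary conditions become
`IsCharRoot`, except that `θ = 0` always solves this equation and counts only for `α = 0`.

For `α > 0` the nonzero roots with nonnegative real part lie in the open fourth quadrant, and each
lies in one open strip `nπ < ℓ Re z < (n+1)π`. There the squared equation has a definite square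
root, `(z - α) e^{i(ℓz - nπ)} = z + α` (`IsBranchPoint`). A strip holds at most one such point
(`IsBranchPoint.unique`): a logarithm of the equation is a function `G` with `Re(-i G') > 0` on the
convex quadrant, hence injective.

Existence inverts the problem. With `z = x - iy` and `φ = ℓx - nπ` in `]0, π[`, eliminating `α`
leaves `y sinh(ℓy) = x sin φ`, which determines `y`, and then `α = A(φ)` is explicit. `A` is
continuous, vanishes at `0` and blows up at `π`; uniqueness in the strip makes it injective, hence
increasing. Its inverse is the branch, so the monotonicity and the limit of `Re θ_n` come for free
(`exists_branch`). A continuous competitor cannot cross the edges of a strip when `α > 0`, which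
gives uniqueness of the family.

The asymptotics read off modulus and argument of `(z - α)/(z + α) = e^{-i(ℓz - nπ)}`: the modulus
gives `Im z`, the argument gives `Re z`. Since `Re z - nν` is bounded and `Im z = O(log n)`, the
limits of `z - α` and `z + α`, suitably scaled, are known (`IsCharBranches.asymptotics`). -/

/-! ### Weak and classical derivatives on an interval. -/

/-- A compactly supported smooth function on `]0, ℓ[` with zero integral is the derivative of a
compactly supported smooth function on `]0, ℓ[`. -/
lemma exists_testFunction_deriv_eq {ℓ : ℝ} {ψ : ℝ → ℝ} (hψ : ContDiff ℝ ∞ ψ)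
    (hc : HasCompactSupport ψ) (hs : tsupport ψ ⊆ Ioo 0 ℓ) (hint : ∫ x, ψ x = 0) :
    ∃ φ : ℝ → ℝ, ContDiff ℝ ∞ φ ∧ HasCompactSupport φ ∧ tsupport φ ⊆ Ioo 0 ℓ ∧ deriv φ = ψ := by
  have hderiv : ∀ y, HasDerivAt (fun y => ∫ t in (0 : ℝ)..y, ψ t) (ψ y) y := fun y =>
    hψ.continuous.integral_hasStrictDerivAt 0 y |>.hasDerivAt
  have hd : deriv (fun y => ∫ t in (0 : ℝ)..y, ψ t) = ψ := funext fun y => (hderiv y).deriv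
  -- The empty support is set apart: its `sInf` and `sSup` would not belong to it.
  rcases (tsupport ψ).eq_empty_or_nonempty with h0 | hne
  · refine ⟨0, contDiff_const, HasCompactSupport.zero, ?_, ?_⟩
    · simp [tsupport]
    · rw [tsupport_eq_empty_iff] at h0
      rw [h0]; ext; simp
  have hK : IsCompact (tsupport ψ) := hc
  have ha := hs (hK.sInf_mem hne)
  have hb := hs (hK.sSup_mem hne)
  set a := sInf (tsupport ψ)
  set b := sSup (tsupport ψ)
  have hψ0 : ∀ y, y ∉ Icc a b → ψ y = 0 := by
    intro y hy
    by_contra h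
    have : y ∈ tsupport ψ := subset_tsupport _ h
    exact hy ⟨csInf_le hK.bddBelow this, le_csSup hK.bddAbove this⟩
  have hsub : Function.support (fun y => ∫ t in (0 : ℝ)..y, ψ t) ⊆ Icc a b := by
    intro y hy
    by_contra h
    apply hy
    rw [mem_Icc, not_and_or, not_le, not_le] at h
    rcases h with h | h
    · refine (intervalIntegral.integral_congr (g := fun _ => 0) fun t ht => ?_).trans (by simp)
      refine hψ0 t fun ht' => ?_
      rcases le_total 0 y with h' | h'
      · rw [uIcc_of_le h'] at ht; linarith [ht.2, ht'.1]
      · rw [uIcc_of_ge h'] at ht; linarith [ht.2, ht'.1, ha.1]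
    -- To the right of `b` the primitive is already the total integral, which is zero.
    · change ∫ t in (0 : ℝ)..y, ψ t = 0
      rw [intervalIntegral.integral_eq_integral_of_support_subset, hint]
      intro t ht
      have : t ∈ Icc a b := by by_contra h'; exact ht (hψ0 t h')
      exact ⟨ha.1.trans_le this.1, this.2.trans h.le⟩
  have hts : tsupport (fun y => ∫ t in (0 : ℝ)..y, ψ t) ⊆ Icc a b :=
    closure_minimal hsub isClosed_Icc
  refine ⟨_, ?_, HasCompactSupport.of_support_subset_isCompact isCompact_Icc hsub,
    hts.trans (Icc_subset_Ioo ha.1 hb.2), hd⟩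
  rw [contDiff_infty_iff_deriv, hd]
  exact ⟨fun y => (hderiv y).differentiableAt, hψ⟩

/-- The du Bois-Reymond lemma for functions which are continuous on `[0, ℓ]`. -/
lemma exists_eqOn_const_of_integral_deriv_smul_eq_zero {ℓ : ℝ} (hℓ : 0 < ℓ) {w : ℝ → ℂ}
    (hw : ContinuousOn w (Icc 0 ℓ))
    (h : ∀ φ : ℝ → ℝ, ContDiff ℝ ∞ φ → HasCompactSupport φ → tsupport φ ⊆ Ioo 0 ℓ →
      ∫ y in Ioo 0 ℓ, deriv φ y • w y = 0) :
    ∃ c : ℂ, EqOn w (fun _ => c) (Icc 0 ℓ) := by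
  let B : ContDiffBump (ℓ / 2) := ⟨ℓ / 6, ℓ / 3, by positivity, by linarith⟩
  set η : ℝ → ℝ := B.normed volume with hη
  have hηd : ContDiff ℝ ∞ η := B.contDiff_normed
  have hηc : HasCompactSupport η := B.hasCompactSupport_normed
  have hηs : tsupport η ⊆ Ioo 0 ℓ := by
    rw [hη, B.tsupport_normed_eq, Real.closedBall_eq_Icc]
    refine Icc_subset_Ioo ?_ ?_ <;> simp only [B] <;> linarith
  have hηi : ∫ x, η x = 1 := B.integral_normed
  have hwi : IntegrableOn w (Ioo 0 ℓ) := (hw.integrableOn_Icc).mono_set Ioo_subset_Icc_self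
  have hmul : ∀ ψ : ℝ → ℝ, Continuous ψ → IntegrableOn (fun y => ψ y • w y) (Ioo 0 ℓ) :=
    fun ψ hψ => ((hψ.continuousOn.smul hw).integrableOn_Icc).mono_set Ioo_subset_Icc_self
  have hset : ∀ ψ : ℝ → ℝ, tsupport ψ ⊆ Ioo 0 ℓ → ∀ f : ℝ → ℂ,
      ∫ y in Ioo 0 ℓ, ψ y • f y = ∫ y, ψ y • f y := fun ψ hψ f =>
    setIntegral_eq_integral_of_forall_compl_eq_zero fun y hy => by
      rw [image_eq_zero_of_notMem_tsupport fun h' => hy (hψ h'), zero_smul]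
  refine ⟨∫ y in Ioo 0 ℓ, η y • w y, ?_⟩
  set c := ∫ y in Ioo 0 ℓ, η y • w y with hc
  have key : ∀ᵐ x ∂volume, x ∈ Ioo 0 ℓ → w x - c = 0 := by
    refine isOpen_Ioo.ae_eq_zero_of_integral_contDiff_smul_eq_zero
      ((hwi.sub (integrableOn_const (by simp))).locallyIntegrableOn) ?_
    intro ψ hψ hψc hψs
    have hψi : Integrable ψ := hψ.continuous.integrable_of_hasCompactSupport hψc
    have hηint : Integrable η := hηd.continuous.integrable_of_hasCompactSupport hηc
    -- Since `η` has integral one, subtracting `(∫ ψ) η` from `ψ` leaves a test function of mean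
    -- zero, hence the derivative of a test function.
    have hds : tsupport (fun x => ψ x - (∫ t, ψ t) * η x) ⊆ Ioo 0 ℓ := by
      refine (tsupport_sub ψ _).trans (union_subset hψs ?_)
      exact (tsupport_mul_subset_right (f := fun _ => ∫ t, ψ t)).trans hηs
    obtain ⟨φ, h1, h2, h3, h4⟩ := exists_testFunction_deriv_eq (ℓ := ℓ)
      (ψ := fun x => ψ x - (∫ t, ψ t) * η x) (hψ.sub (contDiff_const.mul hηd))
      (hψc.sub (hηc.mul_left (f := fun _ => ∫ t, ψ t)))
      hds
      (by rw [integral_sub hψi (hηint.const_mul _), integral_const_mul, hηi]; ring)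
    have h5 := h φ h1 h2 h3
    rw [h4] at h5
    simp only [sub_smul, mul_smul] at h5
    have hηw : IntegrableOn (fun y => (∫ t, ψ t) • η y • w y) (Ioo 0 ℓ) :=
      (hmul η hηd.continuous).smul (∫ t, ψ t)
    rw [integral_sub (hmul ψ hψ.continuous) hηw, integral_smul, ← hc] at h5
    rw [← hset ψ hψs]
    simp only [smul_sub]
    rw [integral_sub (hmul ψ hψ.continuous)
      ((hψi.smul_const c).integrableOn), hset ψ hψs fun _ => c, integral_smul_const, h5]
  have := Measure.eqOn_of_ae_eq (μ := volume) (s := Icc 0 ℓ) (f := w) (g := fun _ => c) ?_ hw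
    continuousOn_const ?_
  · exact this
  · rw [← restrict_Ioo_eq_restrict_Icc]
    rw [Filter.EventuallyEq, ae_restrict_iff' measurableSet_Ioo]
    filter_upwards [key] with x hx hx'
    exact sub_eq_zero.1 (hx hx')
  · rw [interior_Icc, closure_Ioo hℓ.ne]

/-- A primitive of a function which is continuous on an interval. -/
lemma hasDerivWithinAt_of_eqOn_integral {ℓ : ℝ} (hℓ : 0 < ℓ) {u v : ℝ → ℂ} {c : ℂ}
    (hv : ContinuousOn v (Icc 0 ℓ)) (h : ∀ y ∈ Icc 0 ℓ, u y = c + ∫ t in (0 : ℝ)..y, v t) :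
    ∀ y ∈ Icc 0 ℓ, HasDerivWithinAt u (v y) (Icc 0 ℓ) y := by
  intro y hy
  -- A continuous extension to the line lets the fundamental theorem of calculus cover the
  -- endpoints.
  set V : ℝ → ℂ := IccExtend hℓ.le ((Icc 0 ℓ).domRestrict v) with hVdef
  have hV : Continuous V := continuous_IccExtend_iff.2 (continuousOn_iff_continuous_domRestrict.1 hv)
  have hVv : ∀ t ∈ Icc 0 ℓ, V t = v t := fun t ht => by
    rw [hVdef, IccExtend_of_mem _ _ ht]; rfl
  have h1 : HasDerivWithinAt (fun y => c + ∫ t in (0 : ℝ)..y, V t) (V y) (Icc 0 ℓ) y :=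
    ((hV.integral_hasStrictDerivAt 0 y).hasDerivAt.const_add c).hasDerivWithinAt
  rw [← hVv y hy]
  refine h1.congr_of_mem (fun z hz => ?_) hy
  rw [h z hz]
  congr 1
  refine intervalIntegral.integral_congr fun t ht => ?_
  rw [uIcc_of_le hz.1] at ht
  exact (hVv t ⟨ht.1, ht.2.trans hz.2⟩).symm

/-- A continuous weak derivative is a classical derivative. -/
lemma HasWeakDeriv.hasDerivWithinAt {ℓ : ℝ} (hℓ : 0 < ℓ) {u v : ℝ → ℂ}
    (hu : ContinuousOn u (Icc 0 ℓ)) (hv : ContinuousOn v (Icc 0 ℓ)) (h : HasWeakDeriv ℓ u v) :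
    ∀ y ∈ Icc 0 ℓ, HasDerivWithinAt u (v y) (Icc 0 ℓ) y := by
  set V : ℝ → ℂ := fun y => ∫ t in (0 : ℝ)..y, v t with hVdef
  have hV : ∀ y ∈ Icc 0 ℓ, HasDerivWithinAt V (v y) (Icc 0 ℓ) y :=
    hasDerivWithinAt_of_eqOn_integral hℓ (c := 0) hv fun y _ => by simp [hVdef]
  have hVc : ContinuousOn V (Icc 0 ℓ) := fun y hy => (hV y hy).continuousWithinAt
  -- `u` and the primitive `V` of `v` have the same weak derivative, so they differ by a constant.
  obtain ⟨c, hc⟩ := exists_eqOn_const_of_integral_deriv_smul_eq_zero hℓ (hu.sub hVc) (by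
    intro φ h1 h2 h3
    have hφc : Continuous (deriv φ) := h1.continuous_deriv (by simp)
    have e := h φ h1 h2 h3
    have e2 : ∫ y in (0 : ℝ)..ℓ, (deriv φ y • V y + φ y • v y) = 0 := by
      rw [intervalIntegral.integral_deriv_smul_eq_sub_of_hasDeriv_right (u := φ) (u' := deriv φ)
        (v := V) (v' := v)]
      · rw [image_eq_zero_of_notMem_tsupport (f := φ) fun h' => lt_irrefl _ (h3 h').1,
          image_eq_zero_of_notMem_tsupport (f := φ) fun h' => lt_irrefl _ (h3 h').2]
        simp
      · exact h1.continuous.continuousOn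
      · rwa [uIcc_of_le hℓ.le]
      · exact fun x _ => ((h1.differentiable (by simp)) x).hasDerivAt.hasDerivWithinAt
      · rw [min_eq_left hℓ.le, max_eq_right hℓ.le]
        exact fun x hx => ((hV x (Ioo_subset_Icc_self hx)).hasDerivAt
          (Icc_mem_nhds hx.1 hx.2)).hasDerivWithinAt
      · exact hφc.intervalIntegrable _ _
      · exact ContinuousOn.intervalIntegrable (by rwa [uIcc_of_le hℓ.le])
    rw [intervalIntegral.integral_of_le hℓ.le, integral_Ioc_eq_integral_Ioo] at e2
    have hi : ∀ (ψ : ℝ → ℝ) (f : ℝ → ℂ), Continuous ψ → ContinuousOn f (Icc 0 ℓ) →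
        IntegrableOn (fun y => ψ y • f y) (Ioo 0 ℓ) := fun ψ f hψ hf =>
      ((hψ.continuousOn.smul hf).integrableOn_Icc).mono_set Ioo_subset_Icc_self
    rw [integral_add (hi _ _ hφc hVc) (hi _ _ h1.continuous hv)] at e2
    simp only [Pi.sub_apply, smul_sub]
    rw [integral_sub (hi _ _ hφc hu) (hi _ _ hφc hVc), e]
    linear_combination -e2)
  intro y hy
  refine ((hV y hy).const_add c).congr_of_mem (fun z hz => ?_) hy
  have := hc hz
  simp only [Pi.sub_apply] at this
  rw [← this]; ring

/-- A classical derivative is a weak derivative. -/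
lemma HasWeakDeriv.of_hasDerivAt {ℓ : ℝ} (hℓ : 0 < ℓ) {u v : ℝ → ℂ} (hv : Continuous v)
    (h : ∀ y, HasDerivAt u (v y) y) : HasWeakDeriv ℓ u v := by
  intro φ h1 h2 h3
  have hu : Continuous u := continuous_iff_continuousAt.2 fun y => (h y).continuousAt
  have hφc : Continuous (deriv φ) := h1.continuous_deriv (by simp)
  have e2 : ∫ y in (0 : ℝ)..ℓ, (deriv φ y • u y + φ y • v y) = 0 := by
    rw [intervalIntegral.integral_deriv_smul_eq_sub_of_hasDeriv_right (u := φ) (u' := deriv φ)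
      (v := u) (v' := v)]
    · rw [image_eq_zero_of_notMem_tsupport (f := φ) fun h' => lt_irrefl _ (h3 h').1,
        image_eq_zero_of_notMem_tsupport (f := φ) fun h' => lt_irrefl _ (h3 h').2]
      simp
    · exact h1.continuous.continuousOn
    · exact hu.continuousOn
    · exact fun x _ => ((h1.differentiable (by simp)) x).hasDerivAt.hasDerivWithinAt
    · exact fun x _ => (h x).hasDerivWithinAt
    · exact hφc.intervalIntegrable _ _
    · exact hv.intervalIntegrable _ _
  rw [intervalIntegral.integral_of_le hℓ.le, integral_Ioc_eq_integral_Ioo] at e2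
  have hi : ∀ (ψ : ℝ → ℝ) (f : ℝ → ℂ), Continuous ψ → Continuous f →
      IntegrableOn (fun y => ψ y • f y) (Ioo 0 ℓ) := fun ψ f hψ hf =>
    ((hψ.smul hf).continuousOn.integrableOn_Icc).mono_set Ioo_subset_Icc_self
  rw [integral_add (hi _ _ hφc hu) (hi _ _ h1.continuous hv)] at e2
  linear_combination e2

/-- A function with vanishing derivative on `[0, ℓ]` has equal values at the points of `[0, ℓ]`. -/
lemma eq_of_hasDerivWithinAt_zero {ℓ : ℝ} {p : ℝ → ℂ}
    (h : ∀ y ∈ Icc 0 ℓ, HasDerivWithinAt p 0 (Icc 0 ℓ) y) {x y : ℝ} (hx : x ∈ Icc 0 ℓ)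
    (hy : y ∈ Icc 0 ℓ) : p y = p x := by
  have := (convex_Icc 0 ℓ).norm_image_sub_le_of_norm_hasDerivWithin_le (C := 0) h
    (fun z _ => by simp) hx hy
  rw [zero_mul] at this
  exact sub_eq_zero.1 (norm_le_zero_iff.1 this)

/-- An eigenfunction of `T_α` solves the eigenvalue equation in the classical sense. -/
lemma IsEigenvalueT.exists_classical {ℓ : ℝ} (hℓ : 0 < ℓ) {α μ : ℂ} (h : IsEigenvalueT ℓ α μ) :
    ∃ u u₁ : ℝ → ℂ, (∀ y ∈ Icc 0 ℓ, HasDerivWithinAt u (u₁ y) (Icc 0 ℓ) y) ∧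
      (∀ y ∈ Icc 0 ℓ, HasDerivWithinAt u₁ (-(μ * u y)) (Icc 0 ℓ) y) ∧
      u₁ 0 = -(Complex.I * α * u 0) ∧ u₁ ℓ = Complex.I * α * u ℓ ∧ ∃ y ∈ Icc 0 ℓ, u y ≠ 0 := by
  obtain ⟨u, u₁, u₂, hu, hne, hev⟩ := h
  refine ⟨u, u₁, hu.isH2.weakDeriv_one.hasDerivWithinAt hℓ hu.continuousOn_zero
    hu.continuousOn_one, ?_, hu.boundary_left, hu.boundary_right, ?_⟩
  · refine HasWeakDeriv.hasDerivWithinAt hℓ hu.continuousOn_one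
      (hu.continuousOn_zero.const_smul μ).neg ?_
    intro φ h1 h2 h3
    rw [hu.isH2.weakDeriv_two φ h1 h2 h3]
    congr 1
    refine integral_congr_ae ?_
    filter_upwards [hev] with y hy
    rw [← neg_neg (u₂ y), hy]
  · by_contra! h0
    refine hne ?_
    rw [Filter.EventuallyEq, ae_restrict_iff' measurableSet_Ioo]
    exact Eventually.of_forall fun y hy => h0 y (Ioo_subset_Icc_self hy)

/-! ### From eigenvalues to the characteristic equation and back. -/

/-- The exponential `y ↦ e^{c y}` of a real variable. -/
lemma hasDerivAt_cexp_mul_ofReal (c : ℂ) (y : ℝ) :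
    HasDerivAt (fun y : ℝ => Complex.exp (c * y)) (c * Complex.exp (c * y)) y := by
  have h : HasDerivAt (fun y : ℝ => c * (y : ℂ)) c y := by
    simpa using (Complex.ofRealCLM.hasDerivAt (x := y)).const_mul c
  simpa [mul_comm] using h.cexp

/-- For a solution of `u'' = - θ² u`, the quantity `(u' - i θ u) e^{i θ y}` is constant. -/
lemma wave_invariant {ℓ : ℝ} {θ : ℂ} {u u₁ : ℝ → ℂ}
    (h0 : ∀ y ∈ Icc 0 ℓ, HasDerivWithinAt u (u₁ y) (Icc 0 ℓ) y)
    (h1 : ∀ y ∈ Icc 0 ℓ, HasDerivWithinAt u₁ (-(θ ^ 2 * u y)) (Icc 0 ℓ) y)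
    {x y : ℝ} (hx : x ∈ Icc 0 ℓ) (hy : y ∈ Icc 0 ℓ) :
    (u₁ y - Complex.I * θ * u y) * Complex.exp (Complex.I * θ * y) =
      (u₁ x - Complex.I * θ * u x) * Complex.exp (Complex.I * θ * x) := by
  refine eq_of_hasDerivWithinAt_zero
    (p := fun y => (u₁ y - Complex.I * θ * u y) * Complex.exp (Complex.I * θ * y))
    (fun z hz => ?_) hx hy
  have := ((h1 z hz).sub ((h0 z hz).const_mul (Complex.I * θ))).mul
    (hasDerivAt_cexp_mul_ofReal (Complex.I * θ) z).hasDerivWithinAt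
  refine this.congr_deriv ?_
  simp only [Pi.sub_apply]
  linear_combination (-θ ^ 2 * u z * Complex.exp (Complex.I * θ * z)) * Complex.I_sq

/-- The characteristic equation of the eigenvalue problem of `T_α`. -/
def IsCharRoot (ℓ α : ℝ) (θ : ℂ) : Prop :=
  ((α : ℂ) - θ) ^ 2 * Complex.exp (2 * Complex.I * ℓ * θ) = ((α : ℂ) + θ) ^ 2

/-- The wave invariants of `θ` and `-θ`, compared at the two endpoints, give two linear relations
between `u 0` and `u ℓ`; eliminating `u ℓ` gives the equation. The second conclusion discards the
spurious root `θ = 0`. -/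
lemma isCharRoot_of_isEigenvalueT {ℓ : ℝ} (hℓ : 0 < ℓ) {α : ℝ} {θ : ℂ}
    (h : IsEigenvalueT ℓ α (θ ^ 2)) : IsCharRoot ℓ α θ ∧ (θ = 0 → α = 0) := by
  obtain ⟨u, u₁, h0, h1, hl, hr, hne⟩ := h.exists_classical hℓ
  have m0 : (0 : ℝ) ∈ Icc 0 ℓ := ⟨le_rfl, hℓ.le⟩
  have mℓ : ℓ ∈ Icc 0 ℓ := ⟨hℓ.le, le_rfl⟩
  have hp : ∀ y ∈ Icc 0 ℓ, _ := fun y hy => wave_invariant h0 h1 m0 hy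
  have hq : ∀ y ∈ Icc 0 ℓ, _ := fun y hy =>
    wave_invariant (θ := -θ) h0 (by simpa using h1) m0 hy
  -- the boundary values do not both vanish
  have hbd : u 0 ≠ 0 := by
    intro hu0
    rw [hu0, mul_zero, neg_zero] at hl
    simp only [hl, hu0, mul_zero, sub_zero, zero_mul, mul_eq_zero, Complex.exp_ne_zero,
      or_false] at hp hq
    have hu1 : ∀ y ∈ Icc 0 ℓ, u₁ y = 0 := fun y hy => by
      linear_combination (1 / 2 : ℂ) * hp y hy + (1 / 2 : ℂ) * hq y hy
    obtain ⟨y, hy, hyne⟩ := hne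
    apply hyne
    rw [← hu0]
    exact eq_of_hasDerivWithinAt_zero (fun z hz => by simpa [hu1 z hz] using h0 z hz) m0 hy
  set E := Complex.exp (Complex.I * θ * ℓ) with hE
  have hE0 : E ≠ 0 := Complex.exp_ne_zero _
  have hE' : Complex.exp (Complex.I * -θ * ℓ) = E⁻¹ := by
    rw [hE, ← Complex.exp_neg]; congr 1; ring
  have hEE : Complex.exp (2 * Complex.I * ℓ * θ) = E ^ 2 := by
    rw [hE, ← Complex.exp_nat_mul]; congr 1; push_cast; ring
  have e1 := hp ℓ mℓ
  have e2 := hq ℓ mℓ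
  rw [hE', hr, hl] at e2
  rw [← hE, hr, hl] at e1
  simp only [Complex.ofReal_zero, mul_zero, Complex.exp_zero, mul_one] at e1 e2
  have hI : Complex.I ≠ 0 := Complex.I_ne_zero
  have e1' : (α - θ) * u ℓ * E = -(α + θ) * u 0 := by
    apply mul_left_cancel₀ hI; linear_combination e1
  have e2' : (α + θ) * u ℓ = -(α - θ) * u 0 * E := by
    apply mul_left_cancel₀ hI
    have := congrArg (· * E) e2
    simp only [mul_assoc, inv_mul_cancel₀ hE0] at this
    linear_combination this
  constructor
  · rw [IsCharRoot, hEE]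
    apply mul_left_cancel₀ hbd
    linear_combination (α - θ) * E * e2' - (α + θ) * e1'
  -- For `θ = 0` the eigenfunction is affine, and for `α ≠ 0` the boundary conditions require `(iαℓ
  -- - 2) u(0) = 0`, whose factor has real part `-2`.
  · intro hθ
    have hu1 : ∀ y ∈ Icc 0 ℓ, u₁ y = u₁ 0 := fun y hy => by
      simpa [hθ] using hp y hy
    have e3 := eq_of_hasDerivWithinAt_zero (p := fun y => u y - u₁ 0 * y) (fun z hz => by
      have := (h0 z hz).sub
        (((Complex.ofRealCLM.hasDerivAt (x := z)).const_mul (u₁ 0)).hasDerivWithinAt (s := Icc 0 ℓ))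
      exact this.congr_deriv (by simp [hu1 z hz])) m0 mℓ
    simp only [Complex.ofReal_zero, mul_zero, sub_zero] at e3
    have e4 := hu1 ℓ mℓ
    rw [hl] at e3 e4
    rw [hr] at e4
    by_contra hα
    have hα' : (α : ℂ) ≠ 0 := by exact_mod_cast hα
    have e5 : u ℓ = - u 0 := by
      apply mul_left_cancel₀ (mul_ne_zero hI hα'); linear_combination e4
    rw [e5] at e3
    have e6 : (Complex.I * α * ℓ - 2) * u 0 = 0 := by linear_combination e3
    rcases mul_eq_zero.1 e6 with h | h
    · have := congrArg Complex.re h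
      simp at this
    · exact hbd h

/-- The eigenfunction is `cos(θy) - i(α/θ) sin(θy)`: the left boundary condition is built in, and
the right one is the characteristic equation. -/
lemma isEigenvalueT_of_isCharRoot {ℓ : ℝ} (hℓ : 0 < ℓ) {α : ℝ} {θ : ℂ}
    (h : IsCharRoot ℓ α θ) (h0 : θ = 0 → α = 0) : IsEigenvalueT ℓ α (θ ^ 2) := by
  -- `c` stands for `α/θ`; for `θ = α = 0` the value `0` leaves the constant eigenfunction.
  obtain ⟨c, hc⟩ : ∃ c : ℂ, c * θ = α := by
    by_cases hθ : θ = 0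
    · exact ⟨0, by simp [h0 hθ]⟩
    · exact ⟨α / θ, div_mul_cancel₀ _ hθ⟩
  have hcos : ∀ y : ℝ, HasDerivAt (fun y : ℝ => Complex.cos (θ * y)) (-Complex.sin (θ * y) * θ) y :=
    fun y => by
      have h : HasDerivAt (fun y : ℝ => θ * (y : ℂ)) θ y := by
        simpa using (Complex.ofRealCLM.hasDerivAt (x := y)).const_mul θ
      exact (Complex.hasDerivAt_cos (θ * y)).comp y h
  have hsin : ∀ y : ℝ, HasDerivAt (fun y : ℝ => Complex.sin (θ * y)) (Complex.cos (θ * y) * θ) y :=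
    fun y => by
      have h : HasDerivAt (fun y : ℝ => θ * (y : ℂ)) θ y := by
        simpa using (Complex.ofRealCLM.hasDerivAt (x := y)).const_mul θ
      exact (Complex.hasDerivAt_sin (θ * y)).comp y h
  set u : ℝ → ℂ := fun y => Complex.cos (θ * y) - Complex.I * c * Complex.sin (θ * y) with hu
  set u₁ : ℝ → ℂ := fun y => -θ * Complex.sin (θ * y) - Complex.I * α * Complex.cos (θ * y) with hu₁
  have d0 : ∀ y, HasDerivAt u (u₁ y) y := fun y =>
    ((hcos y).sub ((hsin y).const_mul _)).congr_deriv (by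
      simp only [hu₁]; linear_combination (-Complex.I * Complex.cos (θ * y)) * hc)
  have d1 : ∀ y, HasDerivAt u₁ (-(θ ^ 2 * u y)) y := fun y =>
    (((hsin y).const_mul (-θ)).sub ((hcos y).const_mul (Complex.I * α))).congr_deriv (by
      simp only [hu]; linear_combination (-Complex.I * θ * Complex.sin (θ * y)) * hc)
  have c0 : Continuous u := by fun_prop
  have c1 : Continuous u₁ := by fun_prop
  have c2 : Continuous fun y => -(θ ^ 2 * u y) := by fun_prop
  have mem : ∀ f : ℝ → ℂ, Continuous f → MemLp f 2 (volume.restrict (Ioo 0 ℓ)) := fun f hf => by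
    obtain ⟨C, hC⟩ := isCompact_Icc.exists_bound_of_continuousOn (s := Icc 0 ℓ) hf.continuousOn
    refine MemLp.of_bound hf.aestronglyMeasurable C ?_
    rw [ae_restrict_iff' measurableSet_Ioo]
    exact Eventually.of_forall fun y hy => hC y (Ioo_subset_Icc_self hy)
  refine ⟨u, u₁, fun y => -(θ ^ 2 * u y), ⟨⟨mem _ c0, mem _ c1, mem _ c2,
    .of_hasDerivAt hℓ c1 d0, .of_hasDerivAt hℓ c2 d1⟩, c0.continuousOn, c1.continuousOn, ?_, ?_⟩,
    ?_, ?_⟩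
  · simp [hu, hu₁]
  · simp only [hu, hu₁]
    by_cases hθ : θ = 0
    · simp [hθ, h0 hθ]
    · apply mul_left_cancel₀ hθ
      rw [IsCharRoot] at h
      have hE : Complex.exp (2 * Complex.I * ℓ * θ) =
          (Complex.cos (θ * ℓ) + Complex.sin (θ * ℓ) * Complex.I) ^ 2 := by
        rw [← Complex.exp_mul_I, ← Complex.exp_nat_mul]; congr 1; push_cast; ring
      have hcs := Complex.cos_sq_add_sin_sq (θ * ℓ)
      rw [hE] at h
      set C := Complex.cos (θ * ℓ)
      set S := Complex.sin (θ * ℓ)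
      have hne : C + S * Complex.I ≠ 0 := by
        intro h'
        have : (C + S * Complex.I) * (C - S * Complex.I) = 1 := by
          linear_combination hcs - S ^ 2 * Complex.I_sq
        rw [h', zero_mul] at this
        exact zero_ne_one this
      -- Dividing by `e^{iθℓ} = C + iS` makes the equation symmetric, and `h3` is its form in sine
      -- and cosine.
      have h2 : (α - θ) ^ 2 * (C + S * Complex.I) = (α + θ) ^ 2 * (C - S * Complex.I) := by
        apply mul_left_cancel₀ hne
        linear_combination h - (α + θ) ^ 2 * (hcs - S ^ 2 * Complex.I_sq)
      have h3 : (α ^ 2 + θ ^ 2) * S * Complex.I = 2 * α * θ * C := by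
        linear_combination (1 / 2 : ℂ) * h2
      linear_combination Complex.I * h3 - θ ^ 2 * S * Complex.I_sq +
        Complex.I ^ 2 * α * S * hc
  · intro hz
    rw [Filter.EventuallyEq] at hz
    have := Measure.eqOn_of_ae_eq (μ := volume) (s := Icc 0 ℓ) (f := u) (g := fun _ => 0)
      (by rw [← restrict_Ioo_eq_restrict_Icc]; exact hz) c0.continuousOn continuousOn_const
      (by rw [interior_Icc, closure_Ioo hℓ.ne])
    have := this (⟨le_rfl, hℓ.le⟩ : (0 : ℝ) ∈ Icc 0 ℓ)
    simp [hu] at this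
  · exact Eventually.of_forall fun y => by simp

lemma isEigenvalueT_sq_iff {ℓ : ℝ} (hℓ : 0 < ℓ) {α : ℝ} {θ : ℂ} :
    IsEigenvalueT ℓ α (θ ^ 2) ↔ IsCharRoot ℓ α θ ∧ (θ = 0 → α = 0) :=
  ⟨isCharRoot_of_isEigenvalueT hℓ, fun h => isEigenvalueT_of_isCharRoot hℓ h.1 h.2⟩

/-! ### Two inverse functions on the real line. -/

/-- A continuous injective function from `[0, b[` onto `[0, +∞[` has a continuous increasing
inverse. -/
lemma exists_continuousOn_inverse {f : ℝ → ℝ} {b : ℝ} (hb : 0 < b)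
    (hf : ContinuousOn f (Ico 0 b)) (hinj : InjOn f (Ico 0 b)) (h0 : f 0 = 0)
    (hnn : ∀ x ∈ Ico 0 b, 0 ≤ f x) (htop : Tendsto f (𝓝[<] b) atTop) :
    ∃ g : ℝ → ℝ, ContinuousOn g (Ici 0) ∧ StrictMonoOn g (Ici 0) ∧ MapsTo g (Ici 0) (Ico 0 b) ∧
      (∀ t ∈ Ici 0, f (g t) = t) ∧ g 0 = 0 ∧ Tendsto g atTop (𝓝 b) := by
  -- Continuity and injectivity give strict monotonicity up to direction, and `f 0 = 0 ≤ f q` fixes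
  -- the direction.
  have hmono : StrictMonoOn f (Ico 0 b) := by
    intro p hp q hq hpq
    have hsub : Icc 0 q ⊆ Ico 0 b := fun z hz => ⟨hz.1, hz.2.trans_lt hq.2⟩
    exact ContinuousOn.strictMonoOn_of_injOn_Icc hq.1 (by rw [h0]; exact hnn q hq) (hf.mono hsub)
      (hinj.mono hsub) ⟨hp.1, hpq.le⟩ ⟨hq.1, le_rfl⟩ hpq
  have m0 : (0 : ℝ) ∈ Ico 0 b := ⟨le_rfl, hb⟩
  have himg : f '' Ico 0 b = Ici 0 := by
    apply Subset.antisymm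
    · rintro _ ⟨x, hx, rfl⟩
      exact hnn x hx
    · intro t ht
      have := isPreconnected_Ico.intermediate_value_Ici (l := 𝓝[<] b) (f := f) m0
        (by rw [le_principal_iff]; exact Ico_mem_nhdsLT hb) hf htop
      rw [h0] at this
      exact this ht
  let e : Ico 0 b ≃o Ici (0 : ℝ) := (hmono.orderIso f (Ico 0 b)).trans (OrderIso.setCongr _ _ himg)
  have he : ∀ t, f (e.symm t) = t := fun t =>
    congrArg Subtype.val (e.apply_symm_apply t)
  let g : ℝ → ℝ := fun t => e.symm ⟨max 0 t, le_max_left 0 t⟩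
  have hg : ∀ t (ht : t ∈ Ici (0 : ℝ)), g t = e.symm ⟨t, ht⟩ := fun t ht => by
    simp only [g, max_eq_right (mem_Ici.1 ht)]
  have hgm : StrictMonoOn g (Ici 0) := fun s hs t ht hst => by
    rw [hg s hs, hg t ht]
    exact e.symm.strictMono (show (⟨s, hs⟩ : Ici (0 : ℝ)) < ⟨t, ht⟩ from hst)
  have hgmaps : MapsTo g (Ici 0) (Ico 0 b) := fun t ht => by
    rw [hg t ht]; exact (e.symm ⟨t, ht⟩).2
  have hfg : ∀ t ∈ Ici (0 : ℝ), f (g t) = t := fun t ht => by rw [hg t ht, he]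
  refine ⟨g, ?_, hgm, hgmaps, hfg, ?_, ?_⟩
  · exact (continuous_subtype_val.comp (e.symm.continuous.comp
      ((continuous_const.max continuous_id).subtype_mk _))).continuousOn
  · exact hinj (hgmaps self_mem_Ici) m0 (by rw [hfg 0 self_mem_Ici, h0])
  · rw [tendsto_order]
    constructor
    · intro a ha
      set a' := max a 0
      have ha' : a' ∈ Ico 0 b := ⟨le_max_right _ _, max_lt ha hb⟩
      filter_upwards [eventually_gt_atTop (f a'), eventually_ge_atTop 0] with t ht ht0
      have : a' < g t := by
        rw [← hmono.lt_iff_lt ha' (hgmaps ht0), hfg t ht0]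
        exact ht
      exact (le_max_left _ _).trans_lt this
    · intro a ha
      filter_upwards [eventually_ge_atTop 0] with t ht0
      exact (hgmaps ht0).2.trans ha

/-- The continuous inverse of the increasing function `y ↦ |y| sinh (ℓ y)`. -/
lemma exists_continuous_inverse_abs_mul_sinh {ℓ : ℝ} (hℓ : 0 < ℓ) :
    ∃ Y : ℝ → ℝ, Continuous Y ∧ Y 0 = 0 ∧
      ∀ t, 0 < t → 0 < Y t ∧ Y t * Real.sinh (ℓ * Y t) = t := by
  -- The absolute value makes the function odd, hence a bijection of the whole line with a globally
  -- continuous inverse.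
  have hodd : ∀ y : ℝ, |-y| * Real.sinh (ℓ * -y) = -(|y| * Real.sinh (ℓ * y)) := fun y => by
    rw [abs_neg, mul_neg, Real.sinh_neg, mul_neg]
  have hmono : StrictMonoOn (fun y : ℝ => |y| * Real.sinh (ℓ * y)) (Ici 0) := by
    intro p hp q hq hpq
    have hp : 0 ≤ p := hp
    have hq : 0 ≤ q := hq
    simp only [abs_of_nonneg hp, abs_of_nonneg hq]
    have h1 : Real.sinh (ℓ * p) < Real.sinh (ℓ * q) :=
      Real.sinh_lt_sinh.2 (mul_lt_mul_of_pos_left hpq hℓ)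
    have h2 : 0 ≤ Real.sinh (ℓ * p) := Real.sinh_nonneg_iff.2 (by positivity)
    exact mul_lt_mul'' hpq h1 hp h2
  have hm : StrictMono (fun y : ℝ => |y| * Real.sinh (ℓ * y)) :=
    strictMono_of_odd_strictMonoOn_nonneg hodd hmono
  have hc : Continuous (fun y : ℝ => |y| * Real.sinh (ℓ * y)) := by fun_prop
  have htop : Tendsto (fun y : ℝ => |y| * Real.sinh (ℓ * y)) atTop atTop := by
    refine Tendsto.atTop_mul_atTop₀ tendsto_abs_atTop_atTop ?_
    refine tendsto_atTop_mono' _ ?_ (tendsto_id.const_mul_atTop hℓ)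
    filter_upwards [eventually_ge_atTop 0] with y hy
    exact Real.self_le_sinh_iff.2 (by simp only [id]; positivity)
  have hbot : Tendsto (fun y : ℝ => |y| * Real.sinh (ℓ * y)) atBot atBot := by
    have := tendsto_neg_atTop_atBot.comp (htop.comp tendsto_neg_atBot_atTop)
    refine this.congr fun y => ?_
    simp only [Function.comp, hodd, neg_neg]
  let e := hm.orderIsoOfSurjective _ (hc.surjective htop hbot)
  have he : ∀ t, |e.symm t| * Real.sinh (ℓ * e.symm t) = t := fun t => e.apply_symm_apply t
  have h0 : e.symm 0 = 0 := by
    rw [OrderIso.symm_apply_eq]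
    simp [e]
  refine ⟨e.symm, e.symm.continuous, h0, fun t ht => ?_⟩
  have hpos : 0 < e.symm t := by
    rw [← h0]; exact e.symm.strictMono ht
  refine ⟨hpos, ?_⟩
  have := he t
  rwa [abs_of_pos hpos] at this

/-! ### Branch points: equations, uniqueness in a strip, exhaustion. -/

/-- The solutions of the characteristic equation in the `n`-th vertical strip of the lower
half-plane, with the sign of the square root of the equation made explicit. -/
structure IsBranchPoint (ℓ : ℝ) (n : ℕ) (α : ℝ) (z : ℂ) : Prop where
  im_neg : z.im < 0
  lt_re : n * Real.pi < ℓ * z.re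
  re_lt : ℓ * z.re < (n + 1) * Real.pi
  eq : (z - α) * Complex.exp (Complex.I * (ℓ * z - n * Real.pi)) = z + α

lemma IsBranchPoint.re_pos {ℓ : ℝ} (hℓ : 0 < ℓ) {n : ℕ} {α : ℝ} {z : ℂ}
    (h : IsBranchPoint ℓ n α z) : 0 < z.re := by
  have h1 := h.lt_re
  have h2 : 0 ≤ (n : ℝ) * Real.pi := by positivity
  exact pos_of_mul_pos_right (h2.trans_lt h1) hℓ.le

lemma exp_sub_nat_mul_pi (n : ℕ) (z : ℂ) :
    Complex.exp (Complex.I * (z - n * Real.pi)) = Complex.exp (Complex.I * z) * (-1) ^ n := by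
  have h : Complex.exp (-(Real.pi * Complex.I)) = -1 := by
    rw [Complex.exp_neg, Complex.exp_pi_mul_I]; norm_num
  rw [← h, ← Complex.exp_nat_mul, ← Complex.exp_add]
  congr 1
  ring

lemma IsBranchPoint.isCharRoot {ℓ : ℝ} {n : ℕ} {α : ℝ} {z : ℂ} (h : IsBranchPoint ℓ n α z) :
    IsCharRoot ℓ α z := by
  have h1 := h.eq
  rw [exp_sub_nat_mul_pi] at h1
  have h2 : Complex.exp (2 * Complex.I * ℓ * z) =
      (Complex.exp (Complex.I * (ℓ * z)) * (-1) ^ n) ^ 2 := by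
    rw [mul_pow, ← pow_mul, mul_comm n 2, pow_mul, neg_one_sq, one_pow, mul_one,
      ← Complex.exp_nat_mul]
    congr 1; push_cast; ring
  rw [IsCharRoot, h2]
  linear_combination ((z - α) * (Complex.exp (Complex.I * (ℓ * z)) * (-1) ^ n) + (z + α)) * h1

/-- Real and imaginary parts of the equation of the branch points. -/
lemma branch_eq_iff {ℓ : ℝ} (n : ℕ) (α : ℝ) (τ : ℝ) (z : ℂ) :
    (z - α) * Complex.exp (Complex.I * (ℓ * z - n * Real.pi)) = τ * (z + α) ↔
      Real.exp (-(ℓ * z.im)) * ((z.re - α) * Real.cos (ℓ * z.re - n * Real.pi) -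
          z.im * Real.sin (ℓ * z.re - n * Real.pi)) = τ * (z.re + α) ∧
        Real.exp (-(ℓ * z.im)) * ((z.re - α) * Real.sin (ℓ * z.re - n * Real.pi) +
          z.im * Real.cos (ℓ * z.re - n * Real.pi)) = τ * z.im := by
  have he : Complex.exp (Complex.I * (ℓ * z - n * Real.pi)) =
      Real.exp (-(ℓ * z.im)) * (Real.cos (ℓ * z.re - n * Real.pi) +
        Real.sin (ℓ * z.re - n * Real.pi) * Complex.I) := by
    push_cast
    rw [← Complex.exp_mul_I, ← Complex.exp_add]
    congr 1
    nth_rw 1 [← Complex.re_add_im z]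
    linear_combination ℓ * z.im * Complex.I_sq
  rw [he, Complex.ext_iff]
  refine and_congr ?_ ?_
  · simp only [Complex.mul_re, Complex.mul_im, Complex.add_re, Complex.add_im, Complex.sub_re,
      Complex.sub_im, Complex.ofReal_re, Complex.ofReal_im, Complex.I_re, Complex.I_im]
    constructor <;> intro h <;> linear_combination h
  · simp only [Complex.mul_re, Complex.mul_im, Complex.add_re, Complex.add_im, Complex.sub_re,
      Complex.sub_im, Complex.ofReal_re, Complex.ofReal_im, Complex.I_re, Complex.I_im]
    constructor <;> intro h <;> linear_combination h

/-- Elimination of `α` from the equation of the branch points. -/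
lemma IsBranchPoint.im_mul_sinh {ℓ : ℝ} {n : ℕ} {α : ℝ} {z : ℂ} (h : IsBranchPoint ℓ n α z) :
    -z.im * Real.sinh (ℓ * -z.im) = z.re * Real.sin (ℓ * z.re - n * Real.pi) := by
  obtain ⟨h1, h2⟩ := (branch_eq_iff n α 1 z).1 (by simpa using h.eq)
  rw [mul_neg, Real.sinh_eq, neg_neg]
  have h3 : Real.exp (ℓ * z.im) * Real.exp (-(ℓ * z.im)) = 1 := by
    rw [← Real.exp_add, add_neg_cancel, Real.exp_zero]
  have h4 := Real.cos_sq_add_sin_sq (ℓ * z.re - n * Real.pi)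
  set e := Real.exp (-(ℓ * z.im))
  set f := Real.exp (ℓ * z.im)
  set c := Real.cos (ℓ * z.re - n * Real.pi)
  set s := Real.sin (ℓ * z.re - n * Real.pi)
  have h1' : (z.re - α) * c - z.im * s = f * (z.re + α) := by
    linear_combination f * h1 - ((z.re - α) * c - z.im * s) * h3
  have h2' : (z.re - α) * s + z.im * c = f * z.im := by
    linear_combination f * h2 - ((z.re - α) * s + z.im * c) * h3
  -- The weights `s` and `-c` cancel `z.re - α`; the `α` that remains is removed by a further
  -- combination with `h2'`.
  have h5 : -z.im = s * f * (z.re + α) - c * f * z.im := by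
    linear_combination s * h1' - c * h2' + z.im * h4
  linear_combination (1 / 2 : ℝ) * e * h5 + (1 / 2 : ℝ) * (s * (z.re + α) - c * z.im) * h3
    - (1 / 2 : ℝ) * h2'

/-- The converse of the elimination. -/
lemma branch_eq_of_mul_sinh {α x y C S c s e : ℝ} (he : e = C + S) (h1 : C ^ 2 - S ^ 2 = 1)
    (h2 : c ^ 2 + s ^ 2 = 1) (hne : C + c ≠ 0) (hxy : x * s = y * S)
    (hα : α * (C + c) = x * S + y * s) :
    e * ((x - α) * c + y * s) = x + α ∧ e * ((x - α) * s - y * c) = -y := by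
  subst he
  constructor
  · apply mul_left_cancel₀ hne
    linear_combination (-((C + S) * c + 1)) * hα + x * c * h1 + (C + S) * x * h2 -
      (C + S) * s * hxy + y * s * h1
  · apply mul_left_cancel₀ hne
    linear_combination (-(C + S) * s) * hα + x * s * h1 - y * (C + S) * h2 +
      (C + S) * c * hxy - y * c * h1 + hxy

/-- For `α > 0`, each strip contains at most one branch point. -/
lemma IsBranchPoint.unique {ℓ : ℝ} (hℓ : 0 < ℓ) {n : ℕ} {α : ℝ} (hα : 0 < α) {z w : ℂ}
    (hz : IsBranchPoint ℓ n α z) (hw : IsBranchPoint ℓ n α w) : z = w := by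
  by_contra hne
  have hadd : ∀ ζ : ℂ, 0 < ζ.re → ζ + α ≠ 0 := fun ζ h h' => by
    have := congrArg Complex.re h'
    simp at this
    linarith
  have hsub : ∀ ζ : ℂ, ζ.im < 0 → ζ - α ≠ 0 := fun ζ h h' => by
    have := congrArg Complex.im h'
    simp at this
    linarith
  -- The Möbius map sends the open fourth quadrant into the lower half-plane, away from the cut of
  -- the logarithm.
  have hdiv : ∀ ζ : ℂ, 0 < ζ.re → ζ.im < 0 → ((ζ - α) / (ζ + α)).im < 0 := by
    intro ζ h1 h2
    have hN : 0 < Complex.normSq (ζ + α) := Complex.normSq_pos.2 (hadd ζ h1)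
    have : ((ζ - α) / (ζ + α)).im = 2 * α * ζ.im / Complex.normSq (ζ + α) := by
      rw [Complex.div_im]
      simp
      field_simp
      ring
    rw [this]
    exact div_neg_of_neg_of_pos (mul_neg_of_pos_of_neg (by positivity) h2) hN
  set G : ℂ → ℂ := fun ζ => Complex.I * ℓ * ζ + Complex.log ((ζ - α) / (ζ + α)) with hG
  have hGd : ∀ ζ : ℂ, 0 < ζ.re → ζ.im < 0 →
      HasDerivAt G (Complex.I * ℓ + 2 * α / (ζ ^ 2 - α ^ 2)) ζ := by
    intro ζ h1 h2
    have d1 : HasDerivAt (fun ζ : ℂ => (ζ - α) / (ζ + α)) _ ζ :=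
      ((hasDerivAt_id ζ).sub_const (α : ℂ)).div ((hasDerivAt_id ζ).add_const (α : ℂ)) (hadd ζ h1)
    have d2 := ((hasDerivAt_id ζ).const_mul (Complex.I * ℓ)).add
      (d1.clog (Or.inr (hdiv ζ h1 h2).ne))
    refine d2.congr_deriv ?_
    have a1 := hadd ζ h1
    have a2 := hsub ζ h2
    have a3 : ζ ^ 2 - (α : ℂ) ^ 2 ≠ 0 := by
      rw [show ζ ^ 2 - (α : ℂ) ^ 2 = (ζ - α) * (ζ + α) by ring]
      exact mul_ne_zero a2 a1
    simp only [id]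
    field_simp
    ring
  -- In the `n`-th strip the imaginary part of the exponent lies in `]-π, 0[`, so the principal
  -- logarithm inverts the exponential exactly.
  have hval : ∀ ζ : ℂ, IsBranchPoint ℓ n α ζ → G ζ = Complex.I * n * Real.pi := by
    intro ζ h
    have hq : (ζ - α) / (ζ + α) = Complex.exp (-(Complex.I * (ℓ * ζ - n * Real.pi))) := by
      rw [div_eq_iff (hadd ζ (h.re_pos hℓ)), ← h.eq, mul_comm, mul_assoc, ← Complex.exp_add]
      simp
    have him : (-(Complex.I * (ℓ * ζ - n * Real.pi))).im = -(ℓ * ζ.re - n * Real.pi) := by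
      simp
    simp only [hG]
    rw [hq, Complex.log_exp]
    · ring
    · rw [him]; linarith [h.re_lt]
    · rw [him]; linarith [h.lt_re, Real.pi_pos]
  set d := w - z with hd
  have hd0 : d ≠ 0 := sub_ne_zero.2 (Ne.symm hne)
  have hre : ∀ t ∈ Icc (0 : ℝ) 1, 0 < (z + t * d).re := by
    intro t ht
    have h1 := hz.re_pos hℓ
    have h2 := hw.re_pos hℓ
    have : (z + t * d).re = (1 - t) * z.re + t * w.re := by simp [hd]; ring
    rw [this]
    rcases eq_or_lt_of_le ht.1 with h | h
    · rw [← h]; linarith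
    · have := mul_nonneg (sub_nonneg.2 ht.2) h1.le
      have := mul_pos h h2
      linarith
  have him : ∀ t ∈ Icc (0 : ℝ) 1, (z + t * d).im < 0 := by
    intro t ht
    have h1 := hz.im_neg
    have h2 := hw.im_neg
    have : (z + t * d).im = (1 - t) * z.im + t * w.im := by simp [hd]; ring
    rw [this]
    rcases eq_or_lt_of_le ht.1 with h | h
    · rw [← h]; linarith
    · have := mul_nonneg (sub_nonneg.2 ht.2) (neg_nonneg.2 h1.le)
      have := mul_neg_of_pos_of_neg h h2
      linarith
  -- With this factor the derivative of `K * G` along the segment is `|d|²` times `-i G'`. Rolle's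
  -- theorem, applied to the real part, contradicts `Re(-i G') > 0`.
  set K : ℂ := -Complex.I * starRingEnd ℂ d with hK
  have hH : ∀ t ∈ Icc (0 : ℝ) 1, HasDerivAt (fun t : ℝ => (K * G (z + t * d)).re)
      ((K * ((Complex.I * ℓ + 2 * α / ((z + t * d) ^ 2 - α ^ 2)) * d)).re) t := by
    intro t ht
    have e1 : HasDerivAt (fun t : ℝ => z + t * d) d t := by
      simpa using ((Complex.ofRealCLM.hasDerivAt (x := t)).mul_const d).const_add z
    have e2 := ((hGd _ (hre t ht) (him t ht)).comp t e1).const_mul K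
    exact (Complex.reCLM.hasFDerivAt.comp_hasDerivAt t e2)
  obtain ⟨t, ht, hzero⟩ := exists_hasDerivAt_eq_zero (f := fun t : ℝ => (K * G (z + t * d)).re)
    zero_lt_one (fun t ht => (hH t ht).continuousAt.continuousWithinAt)
    (by simp [hd, hval z hz, hval w hw]) (fun t ht => hH t (Ioo_subset_Icc_self ht))
  have ht' := Ioo_subset_Icc_self ht
  set ζ := z + t * d
  have hζ1 : 0 < ζ.re := hre t ht'
  have hζ2 : ζ.im < 0 := him t ht'
  have hrew : K * ((Complex.I * ℓ + 2 * α / (ζ ^ 2 - α ^ 2)) * d) =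
      (Complex.normSq d : ℝ) * ((ℓ : ℝ) + (2 * α : ℝ) * (-Complex.I * (ζ ^ 2 - α ^ 2)⁻¹)) := by
    rw [hK, Complex.normSq_eq_conj_mul_self]
    push_cast
    linear_combination (-(starRingEnd ℂ d) * d * ℓ) * Complex.I_sq
  rw [hrew, Complex.re_ofReal_mul, Complex.add_re, Complex.re_ofReal_mul, Complex.ofReal_re]
    at hzero
  have him2 : (ζ ^ 2 - (α : ℂ) ^ 2).im = 2 * ζ.re * ζ.im := by
    rw [← Complex.ofReal_pow, Complex.sub_im, Complex.ofReal_im, sq, Complex.mul_im]; ring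
  have hneg : (ζ ^ 2 - (α : ℂ) ^ 2).im < 0 := by
    rw [him2]; exact mul_neg_of_pos_of_neg (by positivity) hζ2
  have hpos : 0 < (-Complex.I * (ζ ^ 2 - (α : ℂ) ^ 2)⁻¹).re := by
    have hN : 0 < Complex.normSq (ζ ^ 2 - (α : ℂ) ^ 2) := Complex.normSq_pos.2 fun h => by
      rw [h] at hneg; simp at hneg
    have : (-Complex.I * (ζ ^ 2 - (α : ℂ) ^ 2)⁻¹).re = ((ζ ^ 2 - (α : ℂ) ^ 2)⁻¹).im := by simp
    rw [this, Complex.inv_im]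
    exact div_pos (neg_pos.2 hneg) hN
  have : 0 < Complex.normSq d * (ℓ + 2 * α * (-Complex.I * (ζ ^ 2 - (α : ℂ) ^ 2)⁻¹).re) :=
    mul_pos (Complex.normSq_pos.2 hd0) (by positivity)
  exact this.ne' hzero

/-- For `α > 0`, every nonzero root of the characteristic equation in the closed right half-plane is
a branch point. -/
lemma IsCharRoot.exists_isBranchPoint {ℓ : ℝ} (hℓ : 0 < ℓ) {α : ℝ} (hα : 0 < α) {z : ℂ}
    (h : IsCharRoot ℓ α z) (hre : 0 ≤ z.re) (hz : z ≠ 0) : ∃ n, IsBranchPoint ℓ n α z := by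
  -- Comparing moduli excludes the imaginary axis (where `e^{-ℓ Im z} = 1` forces `z = 0`) and the
  -- half-plane `Im z ≥ 0` (where the left side is too small).
  have hnorm : ((α - z.re) ^ 2 + z.im ^ 2) * Real.exp (-(ℓ * z.im)) ^ 2 =
      (α + z.re) ^ 2 + z.im ^ 2 := by
    have h1 := congrArg (fun w => ‖w‖) h
    simp only [norm_mul, norm_pow, Complex.norm_exp, Complex.sq_norm, Complex.normSq_apply] at h1
    have h2 : (2 * Complex.I * ℓ * z).re = 2 * -(ℓ * z.im) := by simp; ring
    rw [h2, two_mul, Real.exp_add] at h1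
    simp at h1
    linear_combination h1
  have hrepos : 0 < z.re := by
    refine lt_of_le_of_ne hre fun h0 => hz ?_
    rw [← h0, sub_zero, add_zero] at hnorm
    have h1 : Real.exp (-(ℓ * z.im)) ^ 2 = 1 := by
      apply mul_left_cancel₀ (show α ^ 2 + z.im ^ 2 ≠ 0 by positivity)
      rw [hnorm, mul_one]
    have h2 : Real.exp (-(ℓ * z.im)) = 1 := (pow_eq_one_iff_of_nonneg (Real.exp_pos _).le two_ne_zero).1 h1
    rw [Real.exp_eq_one_iff, neg_eq_zero, mul_eq_zero] at h2
    exact Complex.ext h0.symm (h2.resolve_left hℓ.ne')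
  have him : z.im < 0 := by
    by_contra! h0
    have h1 : Real.exp (-(ℓ * z.im)) ^ 2 ≤ 1 :=
      pow_le_one₀ (Real.exp_pos _).le (Real.exp_le_one_iff.2 (by
        have := mul_nonneg hℓ.le h0
        linarith))
    have h2 := mul_le_mul_of_nonneg_left h1
      (show 0 ≤ (α - z.re) ^ 2 + z.im ^ 2 by positivity)
    nlinarith [mul_pos hα hrepos]
  have hx : 0 < ℓ * z.re := mul_pos hℓ hrepos
  set n := ⌊ℓ * z.re / Real.pi⌋₊ with hn
  have hn1 : n * Real.pi ≤ ℓ * z.re := by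
    rw [← le_div_iff₀ Real.pi_pos]
    exact Nat.floor_le (by positivity)
  have hn2 : ℓ * z.re < (n + 1) * Real.pi := by
    rw [← div_lt_iff₀ Real.pi_pos]
    exact Nat.lt_floor_add_one _
  have hτ : ∃ τ : ℝ, (τ = 1 ∨ τ = -1) ∧
      (z - α) * Complex.exp (Complex.I * (ℓ * z - n * Real.pi)) = τ * (z + α) := by
    have h2 : Complex.exp (2 * Complex.I * ℓ * z) =
        (Complex.exp (Complex.I * (ℓ * z - n * Real.pi))) ^ 2 := by
      rw [exp_sub_nat_mul_pi, mul_pow, ← pow_mul, mul_comm n 2, pow_mul, neg_one_sq, one_pow,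
        mul_one, ← Complex.exp_nat_mul]
      congr 1; push_cast; ring
    rw [IsCharRoot, h2] at h
    have h3 : ((z - α) * Complex.exp (Complex.I * (ℓ * z - n * Real.pi))) ^ 2 = (z + α) ^ 2 := by
      linear_combination h
    rcases sq_eq_sq_iff_eq_or_eq_neg.1 h3 with h4 | h4
    · exact ⟨1, Or.inl rfl, by simpa using h4⟩
    · exact ⟨-1, Or.inr rfl, by simpa using h4⟩
  obtain ⟨τ, hτ1, hτ⟩ := hτ
  obtain ⟨e1, e2⟩ := (branch_eq_iff n α τ z).1 hτ
  have hcs := Real.cos_sq_add_sin_sq (ℓ * z.re - n * Real.pi)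
  have hs : 0 ≤ Real.sin (ℓ * z.re - n * Real.pi) :=
    Real.sin_nonneg_of_nonneg_of_le_pi (by linarith) (by linarith)
  have hE : 1 < Real.exp (-(ℓ * z.im)) := by
    rw [Real.one_lt_exp_iff]
    have := mul_neg_of_pos_of_neg hℓ him
    linarith
  have hc := Real.neg_one_le_cos (ℓ * z.re - n * Real.pi)
  have hc' := Real.cos_le_one (ℓ * z.re - n * Real.pi)
  set e := Real.exp (-(ℓ * z.im))
  set c := Real.cos (ℓ * z.re - n * Real.pi) with hcdef
  set s := Real.sin (ℓ * z.re - n * Real.pi) with hsdef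
  -- Positivity of the left side forces `τ sin φ > 0`. As `sin φ ≥ 0`, this selects the sign `τ = 1`
  -- and excludes the left edge of the strip.
  have key : -z.im * (e - τ * c) = τ * s * (z.re + α) := by
    linear_combination s * e1 - c * e2 + z.im * e * hcs
  have hxa : 0 < z.re + α := by positivity
  have hτc : 0 < e - τ * c := by rcases hτ1 with h | h <;> rw [h] <;> linarith
  have hpos : 0 < τ * s * (z.re + α) := by
    rw [← key]; exact mul_pos (neg_pos.2 him) hτc
  have hτs : 0 < τ * s := pos_of_mul_pos_left hpos hxa.le
  have hτeq : τ = 1 := by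
    rcases hτ1 with h | h
    · exact h
    · rw [h] at hτs; linarith
  rw [hτeq, one_mul] at hτs
  refine ⟨n, him, lt_of_le_of_ne hn1 fun h0 => ?_, hn2, by simpa [hτeq] using hτ⟩
  rw [hsdef, h0, sub_self, Real.sin_zero] at hτs
  exact lt_irrefl _ hτs

/-! ### Construction of the branches. -/

/-- The `n`-th branch of solutions of the characteristic equation. -/
theorem exists_branch {ℓ : ℝ} (hℓ : 0 < ℓ) (n : ℕ) :
    ∃ θ : ℝ → ℂ, ContinuousOn θ (Ici 0) ∧ θ 0 = ((n * (Real.pi / ℓ) : ℝ) : ℂ) ∧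
      (∀ α, 0 < α → IsBranchPoint ℓ n α (θ α)) ∧ StrictMonoOn (fun α => (θ α).re) (Ici 0) ∧
      Tendsto (fun α => (θ α).re) atTop (𝓝 ((n + 1) * (Real.pi / ℓ))) := by
  obtain ⟨Y, hYc, hY0, hY⟩ := exists_continuous_inverse_abs_mul_sinh hℓ
  set x : ℝ → ℝ := fun φ => (n * Real.pi + φ) / ℓ with hx
  have hxc : Continuous x := by fun_prop
  set y : ℝ → ℝ := fun φ => Y (x φ * Real.sin φ) with hy
  have hyc : Continuous y := by fun_prop
  have hxpos : ∀ φ, 0 < φ → 0 < x φ := fun φ h => by positivity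
  have hlx : ∀ φ, ℓ * x φ = n * Real.pi + φ := fun φ => mul_div_cancel₀ _ hℓ.ne'
  have hxs : ∀ φ ∈ Ioo 0 Real.pi, 0 < y φ ∧ y φ * Real.sinh (ℓ * y φ) = x φ * Real.sin φ :=
    fun φ h => hY _ (mul_pos (hxpos φ h.1) (Real.sin_pos_of_mem_Ioo h))
  -- Solving for `α` gives `z (E - 1)/(E + 1)` with `E = e^{i(ℓz - nπ)}`; this is its real part, and
  -- its imaginary part vanishes by `hxs`.
  set A : ℝ → ℝ := fun φ => (x φ * Real.sinh (ℓ * y φ) + y φ * Real.sin φ) /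
    (Real.cosh (ℓ * y φ) + Real.cos φ) with hA
  have hden : ∀ φ ∈ Ico 0 Real.pi, 0 < Real.cosh (ℓ * y φ) + Real.cos φ := fun φ h => by
    have h1 := Real.one_le_cosh (ℓ * y φ)
    have h2 : Real.cos Real.pi < Real.cos φ := Real.cos_lt_cos_of_nonneg_of_le_pi h.1 le_rfl h.2
    rw [Real.cos_pi] at h2
    linarith
  have hAc : ContinuousOn A (Ico 0 Real.pi) :=
    ContinuousOn.div (by fun_prop) (by fun_prop) fun φ h => (hden φ h).ne'
  have hy0 : y 0 = 0 := by simp [hy, hY0]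
  have hA0 : A 0 = 0 := by simp [hA, hy0]
  have hSpos : ∀ φ ∈ Ioo 0 Real.pi, 0 < Real.sinh (ℓ * y φ) := fun φ h =>
    Real.sinh_pos_iff.2 (mul_pos hℓ (hxs φ h).1)
  have hApos : ∀ φ ∈ Ioo 0 Real.pi, 0 < A φ := fun φ h =>
    div_pos (add_pos (mul_pos (hxpos φ h.1) (hSpos φ h))
      (mul_pos (hxs φ h).1 (Real.sin_pos_of_mem_Ioo h))) (hden φ (Ioo_subset_Ico_self h))
  have hbr : ∀ φ ∈ Ioo 0 Real.pi, IsBranchPoint ℓ n (A φ) ⟨x φ, -y φ⟩ := by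
    intro φ h
    refine ⟨neg_neg_iff_pos.2 (hxs φ h).1, ?_, ?_, ?_⟩
    · simp only [hlx]; linarith [h.1]
    · simp only [hlx]; linarith [h.2]
    · refine ((branch_eq_iff (ℓ := ℓ) n (A φ) 1 ⟨x φ, -y φ⟩).2 ?_).trans
        (by rw [Complex.ofReal_one, one_mul])
      simp only [hlx, add_sub_cancel_left, mul_neg, neg_neg, one_mul, neg_mul, sub_neg_eq_add,
        ← sub_eq_add_neg]
      exact branch_eq_of_mul_sinh (Real.cosh_add_sinh _).symm (Real.cosh_sq_sub_sinh_sq _)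
        (Real.cos_sq_add_sin_sq φ) (hden φ (Ioo_subset_Ico_self h)).ne' (hxs φ h).2.symm
        (div_mul_cancel₀ _ (hden φ (Ioo_subset_Ico_self h)).ne')
  have hAinj : InjOn A (Ico 0 Real.pi) := by
    intro p hp q hq hpq
    rcases eq_or_lt_of_le hp.1 with h1 | h1 <;> rcases eq_or_lt_of_le hq.1 with h2 | h2
    · rw [← h1, ← h2]
    · have := hApos q ⟨h2, hq.2⟩
      rw [← hpq, ← h1, hA0] at this
      exact absurd this (lt_irrefl _)
    · have := hApos p ⟨h1, hp.2⟩
      rw [hpq, ← h2, hA0] at this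
      exact absurd this (lt_irrefl _)
    · have b1 := hbr p ⟨h1, hp.2⟩
      rw [hpq] at b1
      have := congrArg Complex.re
        (b1.unique hℓ (hApos q ⟨h2, hq.2⟩) (hbr q ⟨h2, hq.2⟩))
      have h3 : ℓ * x p = ℓ * x q := congrArg (ℓ * ·) this
      rw [hlx, hlx] at h3
      linarith
  have hAnn : ∀ φ ∈ Ico 0 Real.pi, 0 ≤ A φ := fun φ h => by
    rcases eq_or_lt_of_le h.1 with h1 | h1
    · rw [← h1, hA0]
    · exact (hApos φ ⟨h1, h.2⟩).le
  have hnear : ∀ᶠ φ in 𝓝[<] Real.pi, φ ∈ Ioo 0 Real.pi := Ioo_mem_nhdsLT Real.pi_pos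
  have hypi : y Real.pi = 0 := by simp [hy, hY0]
  -- The quotient defining `A` is of type `0/0` at `π`; by `hxs` it equals `x (cosh(ℓy) - cos φ) /
  -- sinh(ℓy)`, whose numerator has a positive limit.
  have hAtop : Tendsto A (𝓝[<] Real.pi) atTop := by
    have e1 : Tendsto (fun φ => x φ * (Real.cosh (ℓ * y φ) - Real.cos φ)) (𝓝[<] Real.pi)
        (𝓝 (x Real.pi * (Real.cosh (ℓ * y Real.pi) - Real.cos Real.pi))) :=
      Continuous.continuousWithinAt (by fun_prop)
    have e2 : Tendsto (fun φ => Real.sinh (ℓ * y φ)) (𝓝[<] Real.pi) (𝓝[>] 0) := by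
      rw [tendsto_nhdsWithin_iff]
      constructor
      · have : Tendsto (fun φ => Real.sinh (ℓ * y φ)) (𝓝[<] Real.pi)
          (𝓝 (Real.sinh (ℓ * y Real.pi))) := Continuous.continuousWithinAt (by fun_prop)
        simpa [hypi] using this
      · filter_upwards [hnear] with φ h using hSpos φ h
    have e3 := e1.pos_mul_atTop (by
      have := hxpos _ Real.pi_pos
      rw [hypi, mul_zero, Real.cosh_zero, Real.cos_pi]
      positivity) (tendsto_inv_nhdsGT_zero.comp e2)
    refine e3.congr' ?_
    filter_upwards [hnear] with φ h
    simp only [hA, Function.comp, ← div_eq_mul_inv]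
    rw [div_eq_div_iff (hSpos φ h).ne' (hden φ (Ioo_subset_Ico_self h)).ne']
    have h1 := Real.cosh_sq_sub_sinh_sq (ℓ * y φ)
    have h2 := Real.cos_sq_add_sin_sq φ
    have h3 := (hxs φ h).2
    linear_combination x φ * h1 - x φ * h2 - Real.sin φ * h3
  obtain ⟨g, hgc, hgm, hgmaps, hAg, hg0, hgtop⟩ :=
    exists_continuousOn_inverse Real.pi_pos hAc hAinj hA0 hAnn hAtop
  have hzc : Continuous fun φ => (x φ : ℂ) - y φ * Complex.I := by fun_prop
  have hz : ∀ φ, (x φ : ℂ) - y φ * Complex.I = ⟨x φ, -y φ⟩ := fun φ => by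
    apply Complex.ext <;> simp
  refine ⟨fun α => (x (g α) : ℂ) - y (g α) * Complex.I, hzc.comp_continuousOn hgc, ?_, ?_, ?_, ?_⟩
  · simp only [hg0, hy0, hx]
    push_cast
    ring
  · intro α hα
    have h1 := hgmaps hα.le
    have h2 : 0 < g α := by rw [← hg0]; exact hgm self_mem_Ici hα.le hα
    have := hbr (g α) ⟨h2, h1.2⟩
    rw [hAg α hα.le] at this
    simpa only [hz] using this
  · intro p hp q hq hpq
    simp only [hz]
    exact div_lt_div_of_pos_right (by linarith [hgm hp hq hpq]) hℓ
  · simp only [hz]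
    have := (hxc.tendsto Real.pi).comp hgtop
    rwa [show x Real.pi = (n + 1) * (Real.pi / ℓ) by simp only [hx]; ring] at this

/-! ### The Neumann case, and the family as an enumeration of the spectrum. -/

lemma isCharRoot_zero_natCast {ℓ : ℝ} (hℓ : 0 < ℓ) (n : ℕ) :
    IsCharRoot ℓ 0 ((n * (Real.pi / ℓ) : ℝ) : ℂ) := by
  have h : Complex.exp (2 * Complex.I * ℓ * ((n * (Real.pi / ℓ) : ℝ) : ℂ)) = 1 := by
    rw [Complex.exp_eq_one_iff]
    refine ⟨n, ?_⟩
    have : (ℓ : ℂ) ≠ 0 := by exact_mod_cast hℓ.ne'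
    push_cast
    field_simp
  rw [IsCharRoot, h]
  simp

lemma IsCharRoot.exists_eq_natCast {ℓ : ℝ} (hℓ : 0 < ℓ) {z : ℂ} (h : IsCharRoot ℓ 0 z)
    (hre : 0 ≤ z.re) : ∃ n : ℕ, z = ((n * (Real.pi / ℓ) : ℝ) : ℂ) := by
  by_cases hz : z = 0
  · exact ⟨0, by simp [hz]⟩
  rw [IsCharRoot, Complex.ofReal_zero, zero_sub, zero_add, neg_sq] at h
  have h1 := mul_left_cancel₀ (pow_ne_zero 2 hz) (h.trans (mul_one _).symm)
  obtain ⟨k, hk⟩ := Complex.exp_eq_one_iff.1 h1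
  have hℓ' : (ℓ : ℂ) ≠ 0 := by exact_mod_cast hℓ.ne'
  have hzk : z = ((k * (Real.pi / ℓ) : ℝ) : ℂ) := by
    apply mul_left_cancel₀ (show 2 * Complex.I * ℓ ≠ 0 by simp [hℓ.ne'])
    rw [hk]
    push_cast
    field_simp
  rw [hzk, Complex.ofReal_re] at hre
  have hk0 : 0 ≤ k := by
    by_contra! hneg
    have h2 : (k : ℝ) < 0 := by exact_mod_cast hneg
    have := mul_neg_of_neg_of_pos h2 (div_pos Real.pi_pos hℓ)
    linarith
  lift k to ℕ using hk0
  exact ⟨k, by simpa using hzk⟩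

lemma exists_sq_eq_re_nonneg (μ : ℂ) : ∃ z : ℂ, z ^ 2 = μ ∧ 0 ≤ z.re := by
  obtain ⟨z, hz⟩ := IsAlgClosed.exists_pow_nat_eq μ two_pos
  rcases le_total 0 z.re with h | h
  · exact ⟨z, hz, h⟩
  · exact ⟨-z, by rw [neg_sq, hz], by simpa using h⟩

/-- A family of continuous branches of solutions of the characteristic equation, starting from the
Neumann case. -/
structure IsCharBranches (ℓ : ℝ) (θ : ℕ → ℝ → ℂ) : Prop where
  continuousOn : ∀ n, ContinuousOn (θ n) (Ici 0)
  at_zero : ∀ n, θ n 0 = ((n * (Real.pi / ℓ) : ℝ) : ℂ)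
  isBranchPoint : ∀ n α, 0 < α → IsBranchPoint ℓ n α (θ n α)

namespace IsCharBranches

variable {ℓ : ℝ} {θ : ℕ → ℝ → ℂ}

lemma isCharRoot (h : IsCharBranches ℓ θ) (hℓ : 0 < ℓ) (n : ℕ) {α : ℝ} (hα : 0 ≤ α) :
    IsCharRoot ℓ α (θ n α) := by
  rcases eq_or_lt_of_le hα with h0 | h0
  · rw [← h0, h.at_zero]
    exact isCharRoot_zero_natCast hℓ n
  · exact (h.isBranchPoint n α h0).isCharRoot

lemma isEigenvalueT (h : IsCharBranches ℓ θ) (hℓ : 0 < ℓ) (n : ℕ) {α : ℝ} (hα : 0 ≤ α) :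
    IsEigenvalueT ℓ α (θ n α ^ 2) := by
  refine (isEigenvalueT_sq_iff hℓ).2 ⟨h.isCharRoot hℓ n hα, fun h0 => ?_⟩
  by_contra hne
  have := (h.isBranchPoint n α (lt_of_le_of_ne hα (Ne.symm hne))).im_neg
  rw [h0] at this
  exact lt_irrefl _ this

lemma re_nonneg (h : IsCharBranches ℓ θ) (hℓ : 0 < ℓ) (n : ℕ) {α : ℝ} (hα : 0 ≤ α) :
    0 ≤ (θ n α).re := by
  rcases eq_or_lt_of_le hα with h0 | h0
  · rw [← h0, h.at_zero, Complex.ofReal_re]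
    positivity
  · exact ((h.isBranchPoint n α h0).re_pos hℓ).le

lemma isEigenBranches (h : IsCharBranches ℓ θ) (hℓ : 0 < ℓ) : IsEigenBranches ℓ θ :=
  ⟨h.continuousOn, h.at_zero, fun n _ hα => h.isEigenvalueT hℓ n hα,
    fun n _ hα => h.re_nonneg hℓ n hα⟩

/-- The branches exhaust the eigenvalues. -/
lemma exists_eq (h : IsCharBranches ℓ θ) (hℓ : 0 < ℓ) {α : ℝ} (hα : 0 ≤ α) {z : ℂ}
    (hz : IsEigenvalueT ℓ α (z ^ 2)) (hre : 0 ≤ z.re) : ∃ n, z = θ n α := by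
  obtain ⟨h1, h2⟩ := (isEigenvalueT_sq_iff hℓ).1 hz
  rcases eq_or_lt_of_le hα with h0 | h0
  · rw [← h0] at h1 ⊢
    obtain ⟨n, hn⟩ := h1.exists_eq_natCast hℓ hre
    exact ⟨n, by rw [hn, h.at_zero]⟩
  · obtain ⟨n, hn⟩ := h1.exists_isBranchPoint hℓ h0 hre fun hz0 => h0.ne' (h2 hz0)
    exact ⟨n, hn.unique hℓ h0 (h.isBranchPoint n α h0)⟩

lemma setOf_isEigenvalueT (h : IsCharBranches ℓ θ) (hℓ : 0 < ℓ) {α : ℝ} (hα : 0 ≤ α) :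
    {μ : ℂ | IsEigenvalueT ℓ α μ} = range (fun n => θ n α ^ 2) := by
  apply Subset.antisymm
  · intro μ hμ
    obtain ⟨z, rfl, hz⟩ := exists_sq_eq_re_nonneg μ
    obtain ⟨n, hn⟩ := h.exists_eq hℓ hα hμ hz
    exact ⟨n, by rw [hn]⟩
  · rintro _ ⟨n, rfl⟩
    exact h.isEigenvalueT hℓ n hα

lemma mem_strip (h : IsCharBranches ℓ θ) (hℓ : 0 < ℓ) (n : ℕ) {α : ℝ} (hα : 0 ≤ α) :
    n * Real.pi ≤ ℓ * (θ n α).re ∧ ℓ * (θ n α).re < (n + 1) * Real.pi := by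
  rcases eq_or_lt_of_le hα with h0 | h0
  · rw [← h0, h.at_zero, Complex.ofReal_re,
      show ℓ * (n * (Real.pi / ℓ)) = n * Real.pi by field_simp]
    exact ⟨le_rfl, by linarith [Real.pi_pos]⟩
  · exact ⟨(h.isBranchPoint n α h0).lt_re.le, (h.isBranchPoint n α h0).re_lt⟩

lemma eq_of_mem_strip {m n : ℕ} {x : ℝ} (h1 : n * Real.pi ≤ x) (h2 : x < (n + 1) * Real.pi)
    (h3 : m * Real.pi ≤ x) (h4 : x < (m + 1) * Real.pi) : m = n := by
  have a := lt_of_mul_lt_mul_right (h1.trans_lt h4) Real.pi_pos.le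
  have b := lt_of_mul_lt_mul_right (h3.trans_lt h2) Real.pi_pos.le
  norm_cast at a b
  omega

/-- The half-open strips are disjoint. Opposite roots with nonnegative real parts both have real
part zero, hence share a strip. -/
lemma injective_sq (h : IsCharBranches ℓ θ) (hℓ : 0 < ℓ) {α : ℝ} (hα : 0 ≤ α) :
    Function.Injective (fun n => θ n α ^ 2) := by
  intro m n hmn
  have hm := h.mem_strip hℓ m hα
  have hn := h.mem_strip hℓ n hα
  rcases sq_eq_sq_iff_eq_or_eq_neg.1 hmn with e | e
  · rw [e] at hm
    exact eq_of_mem_strip hn.1 hn.2 hm.1 hm.2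
  · have h1 := h.re_nonneg hℓ m hα
    have h2 := h.re_nonneg hℓ n hα
    rw [e, Complex.neg_re] at h1
    have h3 : (θ n α).re = 0 := by linarith
    rw [e, Complex.neg_re, h3, neg_zero] at hm
    rw [h3] at hn
    exact eq_of_mem_strip hn.1 hn.2 hm.1 hm.2

/-- The branches are determined by continuity. -/
lemma eqOn (h : IsCharBranches ℓ θ) (hℓ : 0 < ℓ) {θ' : ℕ → ℝ → ℂ} (h' : IsEigenBranches ℓ θ')
    (n : ℕ) : EqOn (θ' n) (θ n) (Ici 0) := by
  have hex : ∀ α, 0 < α → ∃ m, θ' n α = θ m α := fun α hα =>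
    h.exists_eq hℓ hα.le (h'.eigenvalue n α hα.le) (h'.re_nonneg n α hα.le)
  have hcont : ContinuousOn (fun α => ℓ * (θ' n α).re) (Ioi 0) :=
    continuousOn_const.mul
      (Complex.continuous_re.comp_continuousOn ((h'.continuousOn n).mono Ioi_subset_Ici_self))
  have key : ∀ a b : ℝ, 0 < a → 0 < b → ∀ k m, θ' n a = θ k a → θ' n b = θ m b → m ≤ k := by
    intro a b ha hb k m hk hm
    by_contra! hlt
    have hlt' : (k : ℝ) + 1 ≤ m := by exact_mod_cast hlt
    have h1 := (h.isBranchPoint k a ha).re_lt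
    have h2 := (h.isBranchPoint m b hb).lt_re
    rw [← hk] at h1
    rw [← hm] at h2
    have h3 : ((k : ℝ) + 1) * Real.pi ≤ m * Real.pi :=
      mul_le_mul_of_nonneg_right hlt' Real.pi_pos.le
    -- To change strips, `ℓ Re` would have to equal a multiple of `π` at some `c > 0`, yet every
    -- root there lies in an open strip.
    obtain ⟨c, hc, hc'⟩ := isPreconnected_Ioi.intermediate_value (mem_Ioi.2 ha) (mem_Ioi.2 hb)
      hcont ⟨h1.le, h3.trans h2.le⟩
    obtain ⟨j, hj⟩ := hex c hc
    have h4 := (h.isBranchPoint j c hc).lt_re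
    have h5 := (h.isBranchPoint j c hc).re_lt
    simp only [hj] at hc'
    rw [hc'] at h4 h5
    have h6 := lt_of_mul_lt_mul_right h4 Real.pi_pos.le
    have h7 := lt_of_mul_lt_mul_right h5 Real.pi_pos.le
    norm_cast at h6 h7
    omega
  obtain ⟨m, hm⟩ := hex 1 one_pos
  have hall : ∀ α, 0 < α → θ' n α = θ m α := by
    intro α hα
    obtain ⟨k, hk⟩ := hex α hα
    rw [hk, le_antisymm (key 1 α one_pos hα m k hm hk) (key α 1 hα one_pos k m hk hm)]
  -- The limit at `0` identifies the index.
  have hmn : m = n := by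
    have t1 : Tendsto (θ' n) (𝓝[>] 0) (𝓝 (θ' n 0)) :=
      ((h'.continuousOn n) 0 self_mem_Ici).mono_left (nhdsWithin_mono _ Ioi_subset_Ici_self)
    have t2 : Tendsto (θ m) (𝓝[>] 0) (𝓝 (θ m 0)) :=
      ((h.continuousOn m) 0 self_mem_Ici).mono_left (nhdsWithin_mono _ Ioi_subset_Ici_self)
    have t3 : Tendsto (θ' n) (𝓝[>] 0) (𝓝 (θ m 0)) := t2.congr' (by
      filter_upwards [self_mem_nhdsWithin] with α hα using (hall α hα).symm)
    have := tendsto_nhds_unique t1 t3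
    rw [h'.at_zero, h.at_zero, Complex.ofReal_inj] at this
    have := mul_right_cancel₀ (div_pos Real.pi_pos hℓ).ne' this
    exact_mod_cast this.symm
  intro α hα
  rcases eq_or_lt_of_le (mem_Ici.1 hα) with h0 | h0
  · rw [← h0, h.at_zero, h'.at_zero]
  · rw [hall α h0, hmn]

end IsCharBranches

/-! ### Bounds on the branches; modulus and argument of the equation. -/

namespace IsBranchPoint

variable {ℓ : ℝ} {n : ℕ} {α : ℝ} {z : ℂ}

lemma re_le (hℓ : 0 < ℓ) (h : IsBranchPoint ℓ n α z) : z.re ≤ (n + 1) * (Real.pi / ℓ) := by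
  rw [← mul_div_assoc, le_div_iff₀ hℓ, mul_comm]
  exact h.re_lt.le

/-- From `sinh t ≥ t`. The right side vanishes as `ℓ Re z` tends to `(n+1)π`, which forces `Im z` to
zero. -/
lemma mul_im_sq_le (hℓ : 0 < ℓ) (h : IsBranchPoint ℓ n α z) :
    ℓ * z.im ^ 2 ≤ z.re * Real.sin (ℓ * z.re - n * Real.pi) := by
  have h0 : 0 < -z.im := neg_pos.2 h.im_neg
  rw [← h.im_mul_sinh]
  have := mul_le_mul_of_nonneg_left
    (Real.self_le_sinh_iff.2 (show 0 ≤ ℓ * -z.im by positivity)) h0.le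
  linarith

/-- The imaginary parts of the branch points of index `n` are logarithmically bounded. -/
lemma neg_im_le (hℓ : 0 < ℓ) (h : IsBranchPoint ℓ n α z) :
    -z.im ≤ 1 + Real.log (2 * ((n + 1) * (Real.pi / ℓ)) + 1) / ℓ := by
  have hlog : 0 ≤ Real.log (2 * ((n + 1) * (Real.pi / ℓ)) + 1) / ℓ := by
    refine div_nonneg (Real.log_nonneg ?_) hℓ.le
    have : 0 ≤ 2 * ((n + 1) * (Real.pi / ℓ)) := by positivity
    linarith
  -- Once `-z.im ≥ 1`, the factor `-z.im` can be dropped, so `sinh(ℓ · -z.im)` is at most linear in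
  -- `n`.
  rcases le_total (-z.im) 1 with h1 | h1
  · linarith
  have hs : 0 ≤ Real.sinh (ℓ * -z.im) := Real.sinh_nonneg_iff.2 (by positivity)
  have h2 : Real.sinh (ℓ * -z.im) ≤ (n + 1) * (Real.pi / ℓ) := by
    calc Real.sinh (ℓ * -z.im) ≤ -z.im * Real.sinh (ℓ * -z.im) := le_mul_of_one_le_left hs h1
      _ = z.re * Real.sin (ℓ * z.re - n * Real.pi) := h.im_mul_sinh
      _ ≤ z.re := mul_le_of_le_one_right (h.re_pos hℓ).le (Real.sin_le_one _)
      _ ≤ _ := h.re_le hℓ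
  rw [Real.sinh_eq] at h2
  have h3 : Real.exp (-(ℓ * -z.im)) ≤ 1 := Real.exp_le_one_iff.2 (by
    have : 0 ≤ ℓ * -z.im := by positivity
    linarith)
  have h4 : ℓ * -z.im ≤ Real.log (2 * ((n + 1) * (Real.pi / ℓ)) + 1) := by
    rw [Real.le_log_iff_exp_le (by positivity)]
    linarith
  have h5 : -z.im ≤ Real.log (2 * ((n + 1) * (Real.pi / ℓ)) + 1) / ℓ := by
    rw [le_div_iff₀ hℓ, mul_comm]; exact h4
  linarith

lemma add_ne_zero (h : IsBranchPoint ℓ n α z) : z + α ≠ 0 := fun h0 => by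
  have := congrArg Complex.im h0
  simp only [Complex.add_im, Complex.ofReal_im, add_zero, Complex.zero_im] at this
  exact h.im_neg.ne this

lemma div_eq (h : IsBranchPoint ℓ n α z) :
    (z - α) / (z + α) = Complex.exp (-(Complex.I * (ℓ * z - n * Real.pi))) := by
  rw [div_eq_iff h.add_ne_zero, ← h.eq, mul_comm, mul_assoc, ← Complex.exp_add]
  simp

lemma norm_div_eq (h : IsBranchPoint ℓ n α z) : ‖(z - α) / (z + α)‖ = Real.exp (ℓ * z.im) := by
  rw [h.div_eq, Complex.norm_exp]
  congr 1
  simp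

/-- The angle `ℓ Re z - nπ` lies in `]0, π[`, so its cosine determines it. -/
lemma arccos_eq (h : IsBranchPoint ℓ n α z) :
    Real.arccos (((z - α) / (z + α)).re / ‖(z - α) / (z + α)‖) = ℓ * z.re - n * Real.pi := by
  have h1 : ((z - α) / (z + α)).re =
      Real.exp (ℓ * z.im) * Real.cos (ℓ * z.re - n * Real.pi) := by
    rw [h.div_eq, Complex.exp_re, ← Real.cos_neg (ℓ * z.re - n * Real.pi)]
    congr 2 <;> simp
  rw [h1, h.norm_div_eq, mul_div_cancel_left₀ _ (Real.exp_pos _).ne', Real.arccos_cos]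
  · linarith [h.lt_re]
  · linarith [h.re_lt]

end IsBranchPoint

namespace IsCharBranches

variable {ℓ : ℝ} {θ : ℕ → ℝ → ℂ}

lemma tendsto_im (h : IsCharBranches ℓ θ) (hℓ : 0 < ℓ) (n : ℕ)
    (hre : Tendsto (fun α => (θ n α).re) atTop (𝓝 ((n + 1) * (Real.pi / ℓ)))) :
    Tendsto (fun α => (θ n α).im) atTop (𝓝 0) := by
  have h1 : Tendsto (fun α => (θ n α).re * Real.sin (ℓ * (θ n α).re - n * Real.pi)) atTop
      (𝓝 0) := by
    have hc : Continuous fun x : ℝ => x * Real.sin (ℓ * x - n * Real.pi) := by fun_prop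
    have := (hc.tendsto _).comp hre
    have e : ℓ * ((n + 1) * (Real.pi / ℓ)) - n * Real.pi = Real.pi := by field_simp; ring
    simpa only [e, Real.sin_pi, mul_zero, Function.comp_def] using this
  have h2 : Tendsto (fun α => ℓ * (θ n α).im ^ 2) atTop (𝓝 0) := by
    refine tendsto_of_tendsto_of_tendsto_of_le_of_le' tendsto_const_nhds h1
      (Eventually.of_forall fun α => by positivity) ?_
    filter_upwards [eventually_gt_atTop 0] with α hα
    exact (h.isBranchPoint n α hα).mul_im_sq_le hℓ
  have h3 : Tendsto (fun α => (θ n α).im ^ 2) atTop (𝓝 0) := by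
    have := h2.const_mul ℓ⁻¹
    simpa [hℓ.ne'] using this
  have h4 := (Real.continuous_sqrt.tendsto 0).comp h3
  rw [Real.sqrt_zero] at h4
  rw [tendsto_zero_iff_abs_tendsto_zero]
  exact h4.congr fun α => Real.sqrt_sq_eq_abs _

lemma abs_im_le (h : IsCharBranches ℓ θ) (hℓ : 0 < ℓ) (n : ℕ) {α : ℝ} (hα : 0 ≤ α) :
    |(θ n α).im| ≤ 1 + Real.log (2 * ((n + 1) * (Real.pi / ℓ)) + 1) / ℓ := by
  rcases eq_or_lt_of_le hα with h0 | h0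
  · rw [← h0, h.at_zero, Complex.ofReal_im, abs_zero]
    have : 0 ≤ Real.log (2 * ((n + 1) * (Real.pi / ℓ)) + 1) / ℓ := by
      refine div_nonneg (Real.log_nonneg ?_) hℓ.le
      have : 0 ≤ 2 * ((n + 1) * (Real.pi / ℓ)) := by positivity
      linarith
    linarith
  · rw [abs_of_neg (h.isBranchPoint n α h0).im_neg]
    exact (h.isBranchPoint n α h0).neg_im_le hℓ

end IsCharBranches

lemma tendsto_log_natCast : Tendsto (fun n : ℕ => Real.log n) atTop atTop :=
  Real.tendsto_log_atTop.comp tendsto_natCast_atTop_atTop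

lemma isBigO_im_bound {ℓ : ℝ} (hℓ : 0 < ℓ) :
    (fun n : ℕ => 1 + Real.log (2 * ((n + 1) * (Real.pi / ℓ)) + 1) / ℓ) =O[atTop]
      fun n : ℕ => Real.log n := by
  have hconst : ∀ c : ℝ, (fun _ : ℕ => c) =O[atTop] fun n : ℕ => Real.log n := fun c =>
    ((Asymptotics.isLittleO_const_left).2 (Or.inr
      (tendsto_norm_atTop_atTop.comp tendsto_log_natCast))).isBigO
  refine (hconst 1).add ?_
  -- For `n ≥ 1`, `2(n+1)ν + 1 ≤ (4ν + 1) n`.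
  have h1 : (fun n : ℕ => Real.log (2 * ((n + 1) * (Real.pi / ℓ)) + 1)) =O[atTop]
      fun n : ℕ => Real.log (4 * (Real.pi / ℓ) + 1) + Real.log n := by
    refine Asymptotics.IsBigO.of_bound 1 ?_
    filter_upwards [eventually_ge_atTop 1] with n hn
    have hn' : (1 : ℝ) ≤ n := by exact_mod_cast hn
    have hν : 0 < Real.pi / ℓ := div_pos Real.pi_pos hℓ
    have h0 : 0 ≤ 2 * ((n + 1) * (Real.pi / ℓ)) := by positivity
    rw [← Real.log_mul (by positivity) (by positivity), one_mul, Real.norm_eq_abs,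
      Real.norm_eq_abs, abs_of_nonneg (Real.log_nonneg (by linarith))]
    refine le_trans (Real.log_le_log (by linarith) ?_) (le_abs_self _)
    nlinarith
  have h2 := h1.trans ((hconst _).add (Asymptotics.isBigO_refl _ _))
  simpa [div_eq_inv_mul] using h2.const_mul_left ℓ⁻¹

namespace IsCharBranches

variable {ℓ : ℝ} {θ : ℕ → ℝ → ℂ}

lemma bddAbove_abs_im (h : IsCharBranches ℓ θ) (hℓ : 0 < ℓ) (n : ℕ) :
    BddAbove ((fun α => |(θ n α).im|) '' Ici 0) :=
  ⟨_, by rintro _ ⟨α, hα, rfl⟩; exact h.abs_im_le hℓ n hα⟩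

lemma isBigO_sSup_abs_im (h : IsCharBranches ℓ θ) (hℓ : 0 < ℓ) :
    (fun n : ℕ => sSup ((fun α => |(θ n α).im|) '' Ici 0)) =O[atTop]
      fun n : ℕ => Real.log n := by
  refine Asymptotics.IsBigO.trans (Asymptotics.IsBigO.of_bound 1 ?_) (isBigO_im_bound hℓ)
  refine Eventually.of_forall fun n => ?_
  have h0 : 0 ≤ sSup ((fun α => |(θ n α).im|) '' Ici 0) :=
    Real.sSup_nonneg (by rintro _ ⟨α, -, rfl⟩; exact abs_nonneg _)
  rw [Real.norm_eq_abs, abs_of_nonneg h0, one_mul]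
  refine le_trans (csSup_le (nonempty_Ici.image _) ?_) (le_abs_self _)
  rintro _ ⟨α, hα, rfl⟩
  exact h.abs_im_le hℓ n hα

lemma isBigO_im (h : IsCharBranches ℓ θ) (hℓ : 0 < ℓ) {a : ℕ → ℝ}
    (ha : ∀ᶠ n in atTop, 0 < a n) :
    (fun n : ℕ => (θ n (a n)).im) =O[atTop] fun n : ℕ => Real.log n := by
  refine Asymptotics.IsBigO.trans (Asymptotics.IsBigO.of_bound 1 ?_) (isBigO_im_bound hℓ)
  filter_upwards [ha] with n hn
  rw [one_mul, Real.norm_eq_abs]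
  exact (h.abs_im_le hℓ n hn.le).trans (le_abs_self _)

lemma eventually_isBranchPoint (h : IsCharBranches ℓ θ) {a : ℕ → ℝ}
    (ha : ∀ᶠ n in atTop, 0 < a n) : ∀ᶠ n in atTop, IsBranchPoint ℓ n (a n) (θ n (a n)) :=
  ha.mono fun n hn => h.isBranchPoint n _ hn

lemma isBigO_re_sub (h : IsCharBranches ℓ θ) (hℓ : 0 < ℓ) {a : ℕ → ℝ}
    (ha : ∀ᶠ n in atTop, 0 < a n) :
    (fun n : ℕ => (θ n (a n)).re - n * (Real.pi / ℓ)) =O[atTop] fun _ => (1 : ℝ) := by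
  refine Asymptotics.IsBigO.of_bound (Real.pi / ℓ) ?_
  filter_upwards [h.eventually_isBranchPoint ha] with n hn
  have h1 : n * (Real.pi / ℓ) ≤ (θ n (a n)).re := by
    rw [← mul_div_assoc, div_le_iff₀ hℓ, mul_comm (θ n (a n)).re]
    exact hn.lt_re.le
  rw [Real.norm_eq_abs, abs_of_nonneg (by linarith), norm_one, mul_one]
  have := hn.re_le hℓ
  linarith

lemma tendsto_re_sub_div (h : IsCharBranches ℓ θ) (hℓ : 0 < ℓ) {a q : ℕ → ℝ}
    (ha : ∀ᶠ n in atTop, 0 < a n) (hq : Tendsto q atTop atTop) :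
    Tendsto (fun n => ((θ n (a n)).re - n * (Real.pi / ℓ)) / q n) atTop (𝓝 0) :=
  ((h.isBigO_re_sub hℓ ha).trans_isLittleO ((Asymptotics.isLittleO_const_left).2 (Or.inr
    (tendsto_norm_atTop_atTop.comp hq)))).tendsto_div_nhds_zero

lemma tendsto_add_div_natCast (h : IsCharBranches ℓ θ) (hℓ : 0 < ℓ) {δ : ℕ → ℝ} {D' : ℝ}
    (hδn : Tendsto (fun n : ℕ => δ n / n) atTop (𝓝 D'))
    (ha : ∀ᶠ n : ℕ in atTop, 0 < n * (Real.pi / ℓ) + δ n) :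
    Tendsto (fun n : ℕ => (θ n (n * (Real.pi / ℓ) + δ n) + (n * (Real.pi / ℓ) + δ n : ℝ)) / (n : ℂ))
      atTop (𝓝 ((2 * (Real.pi / ℓ) + D' : ℝ) : ℂ)) := by
  have hnat : Tendsto (fun n : ℕ => (n : ℝ)) atTop atTop := tendsto_natCast_atTop_atTop
  set ν := Real.pi / ℓ
  set z : ℕ → ℂ := fun n => θ n (n * ν + δ n) with hz
  have hre0 : Tendsto (fun n : ℕ => ((z n).re - n * ν) / n) atTop (𝓝 0) :=
    h.tendsto_re_sub_div hℓ ha hnat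
  have him0 : Tendsto (fun n : ℕ => (z n).im / n) atTop (𝓝 0) := ((h.isBigO_im hℓ ha).trans_isLittleO
    ((Real.isLittleO_log_id_atTop).comp_tendsto hnat)).tendsto_div_nhds_zero
  have h1 := ((hre0.ofReal.add hδn.ofReal).add (him0.ofReal.mul_const Complex.I)).add_const
    ((2 * ν : ℝ) : ℂ)
  have e : ((0 : ℝ) : ℂ) + (D' : ℂ) + ((0 : ℝ) : ℂ) * Complex.I + ((2 * ν : ℝ) : ℂ) =
      ((2 * ν + D' : ℝ) : ℂ) := by push_cast; ring
  rw [e] at h1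
  refine h1.congr' ?_
  filter_upwards [eventually_gt_atTop 0] with n hn
  have hn' : (n : ℂ) ≠ 0 := by exact_mod_cast hn.ne'
  change _ = (z n + (n * ν + δ n : ℝ)) / (n : ℂ)
  nth_rw 3 [← Complex.re_add_im (z n)]
  push_cast
  field_simp
  ring

/-! ### Asymptotics for large index. -/

/-- The general asymptotic statement for `α = n π / ℓ + δ n`. -/
lemma asymptotics (h : IsCharBranches ℓ θ) (hℓ : 0 < ℓ) {δ p : ℕ → ℝ} {D D' Z : ℝ}
    (hp : Tendsto p atTop atTop) (hδp : Tendsto (fun n => δ n / p n) atTop (𝓝 D))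
    (hδn : Tendsto (fun n : ℕ => δ n / n) atTop (𝓝 D'))
    (hZ : Tendsto (fun n => (θ n (n * (Real.pi / ℓ) + δ n)).im / p n) atTop (𝓝 Z))
    (hD' : 0 < 2 * (Real.pi / ℓ) + D') (hne : D ≠ 0 ∨ Z ≠ 0)
    (ha : ∀ᶠ n : ℕ in atTop, 0 < n * (Real.pi / ℓ) + δ n) :
    Tendsto (fun n : ℕ => (θ n (n * (Real.pi / ℓ) + δ n)).re - n * (Real.pi / ℓ)) atTop
        (𝓝 (Real.arccos (-D / ‖(-D + Z * Complex.I : ℂ)‖) / ℓ)) ∧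
      Tendsto (fun n : ℕ => ℓ * -(θ n (n * (Real.pi / ℓ) + δ n)).im - Real.log (n / p n)) atTop
        (𝓝 (-Real.log (‖(-D + Z * Complex.I : ℂ)‖ / (2 * (Real.pi / ℓ) + D')))) := by
  set ν := Real.pi / ℓ with hν
  set z : ℕ → ℂ := fun n => θ n (n * ν + δ n) with hz
  have hbr : ∀ᶠ n : ℕ in atTop, IsBranchPoint ℓ n (n * ν + δ n) (z n) :=
    h.eventually_isBranchPoint ha
  have hre0 : Tendsto (fun n : ℕ => ((z n).re - n * ν) / p n) atTop (𝓝 0) :=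
    h.tendsto_re_sub_div hℓ ha hp
  -- At scale `p n` the bounded quantity `Re z - nν` disappears, leaving `-D` from the detuning and
  -- `Z` from the imaginary part.
  have hnum : Tendsto (fun n => (z n - (n * ν + δ n : ℝ)) / (p n : ℂ)) atTop
      (𝓝 (-D + Z * Complex.I)) := by
    have hZ' : Tendsto (fun n => (z n).im / p n) atTop (𝓝 Z) := hZ
    have h1 := (hre0.ofReal.sub hδp.ofReal).add (hZ'.ofReal.mul_const Complex.I)
    rw [Complex.ofReal_zero, zero_sub] at h1
    refine h1.congr fun n => ?_
    nth_rw 3 [← Complex.re_add_im (z n)]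
    push_cast
    ring
  have hden : Tendsto (fun n : ℕ => (z n + (n * ν + δ n : ℝ)) / (n : ℂ)) atTop
      (𝓝 ((2 * ν + D' : ℝ) : ℂ)) :=
    h.tendsto_add_div_natCast hℓ hδn ha
  have hD'c : ((2 * ν + D' : ℝ) : ℂ) ≠ 0 := by exact_mod_cast hD'.ne'
  set v : ℂ := (-D + Z * Complex.I) / ((2 * ν + D' : ℝ) : ℂ) with hv
  set V : ℕ → ℂ := fun n => ((z n - (n * ν + δ n : ℝ)) / (p n : ℂ)) /
    ((z n + (n * ν + δ n : ℝ)) / (n : ℂ)) with hV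
  have hVv : Tendsto V atTop (𝓝 v) := hnum.div hden hD'c
  have hne' : (-D + Z * Complex.I : ℂ) ≠ 0 := by
    intro h0
    have h1 := congrArg Complex.re h0
    have h2 := congrArg Complex.im h0
    simp at h1 h2
    tauto
  have hv0 : v ≠ 0 := div_ne_zero hne' hD'c
  have hnormv : ‖v‖ = ‖(-D + Z * Complex.I : ℂ)‖ / (2 * ν + D') := by
    rw [hv, norm_div, Complex.norm_real, Real.norm_eq_abs, abs_of_pos hD']
  -- The positive factor `p n / n` does not change the argument; in the modulus it produces the term
  -- `log(n / p n)`.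
  have hWV : ∀ᶠ n : ℕ in atTop, 0 < p n / n ∧
      (z n - (n * ν + δ n : ℝ)) / (z n + (n * ν + δ n : ℝ)) = (p n / n : ℝ) * V n := by
    filter_upwards [hbr, hp.eventually_gt_atTop 0, eventually_gt_atTop 0] with n hn hpn hn0
    have h1 := hn.add_ne_zero
    have h2 : (p n : ℂ) ≠ 0 := by exact_mod_cast hpn.ne'
    have h3 : (n : ℂ) ≠ 0 := by exact_mod_cast hn0.ne'
    refine ⟨by positivity, ?_⟩
    simp only [hV]
    push_cast at h1 ⊢
    field_simp
  constructor
  · have h1 : Tendsto (fun n => Real.arccos ((V n).re / ‖V n‖) / ℓ) atTop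
        (𝓝 (Real.arccos (v.re / ‖v‖) / ℓ)) :=
      ((Real.continuous_arccos.tendsto _).comp
        (((Complex.continuous_re.tendsto v).comp hVv).div hVv.norm (norm_ne_zero_iff.2 hv0))
        ).div_const ℓ
    have e : v.re / ‖v‖ = -D / ‖(-D + Z * Complex.I : ℂ)‖ := by
      rw [hnormv, hv, Complex.div_ofReal_re]
      simp only [Complex.add_re, Complex.neg_re, Complex.ofReal_re, Complex.mul_re, Complex.I_re,
        mul_zero, Complex.ofReal_im, Complex.I_im, zero_mul, sub_zero, add_zero]
      rw [div_div_div_cancel_right₀ hD'.ne']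
    rw [e] at h1
    refine h1.congr' ?_
    filter_upwards [hbr, hWV] with n hn hW
    have h2 := hn.arccos_eq
    rw [hW.2, norm_mul, Complex.re_ofReal_mul, Complex.norm_real, Real.norm_eq_abs,
      abs_of_pos hW.1, mul_div_mul_left _ _ hW.1.ne'] at h2
    rw [h2]
    change _ = (z n).re - n * ν
    rw [hν]
    field_simp
  · have h1 : Tendsto (fun n => -Real.log ‖V n‖) atTop (𝓝 (-Real.log ‖v‖)) :=
      ((Real.continuousAt_log (norm_ne_zero_iff.2 hv0)).tendsto.comp hVv.norm).neg
    rw [hnormv] at h1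
    refine h1.congr' ?_
    filter_upwards [hbr, hWV] with n hn hW
    have h2 := hn.norm_div_eq
    have hV0 : ‖V n‖ ≠ 0 := by
      intro h0
      rw [hW.2, norm_mul, h0, mul_zero] at h2
      exact (Real.exp_pos _).ne h2
    rw [hW.2, norm_mul, Complex.norm_real, Real.norm_eq_abs, abs_of_pos hW.1] at h2
    have h3 := congrArg Real.log h2
    rw [Real.log_mul hW.1.ne' hV0, Real.log_exp, ← inv_div, Real.log_inv] at h3
    linarith

end IsCharBranches

namespace IsCharBranches

variable {ℓ : ℝ} {θ : ℕ → ℝ → ℂ}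

/-- The imaginary part of the branches at logarithmic distance of the resonance. -/
lemma tendsto_im_div_log (h : IsCharBranches ℓ θ) (hℓ : 0 < ℓ) (β : ℝ)
    (ha : ∀ᶠ n : ℕ in atTop, 0 < n * (Real.pi / ℓ) + β * Real.log n) :
    Tendsto (fun n : ℕ => (θ n (n * (Real.pi / ℓ) + β * Real.log n)).im / Real.log n) atTop
      (𝓝 (-1 / ℓ)) := by
  have hnat : Tendsto (fun n : ℕ => (n : ℝ)) atTop atTop := tendsto_natCast_atTop_atTop
  have hlogo : (fun n : ℕ => Real.log n) =o[atTop] fun n : ℕ => (n : ℝ) :=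
    Real.isLittleO_log_id_atTop.comp_tendsto hnat
  have hδn : Tendsto (fun n : ℕ => β * Real.log n / n) atTop (𝓝 0) := by
    simpa [mul_div_assoc] using hlogo.tendsto_div_nhds_zero.const_mul β
  have hden := h.tendsto_add_div_natCast hℓ hδn ha
  have hbr := h.eventually_isBranchPoint ha
  have hreO := h.isBigO_re_sub hℓ ha
  have himO := h.isBigO_im hℓ ha
  set ν := Real.pi / ℓ with hν
  have hν0 : 0 < ν := div_pos Real.pi_pos hℓ
  set z : ℕ → ℂ := fun n => θ n (n * ν + β * Real.log n) with hz
  set num : ℕ → ℂ := fun n => z n - (n * ν + β * Real.log n : ℝ) with hnum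
  set den : ℕ → ℂ := fun n => z n + (n * ν + β * Real.log n : ℝ) with hden'
  have hone : (fun _ : ℕ => (1 : ℝ)) =O[atTop] fun n : ℕ => Real.log n :=
    ((Asymptotics.isLittleO_const_left).2 (Or.inr
      (tendsto_norm_atTop_atTop.comp tendsto_log_natCast))).isBigO
  have hnumO : num =O[atTop] fun n : ℕ => Real.log n := by
    have h1 : (fun n : ℕ => ((z n).re - n * ν) - β * Real.log n) =O[atTop]
        fun n : ℕ => Real.log n :=
      (hreO.trans hone).sub ((Asymptotics.isBigO_refl _ _).const_mul_left β)
    refine Asymptotics.IsBigO.trans (Asymptotics.IsBigO.of_bound 1 ?_)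
      (h1.norm_left.add himO.norm_left)
    refine Eventually.of_forall fun n => ?_
    have h2 := Complex.norm_le_abs_re_add_abs_im (num n)
    have h3 : (num n).re = (z n).re - n * ν - β * Real.log n := by
      simp only [hnum, Complex.sub_re, Complex.ofReal_re]; ring
    have h4 : (num n).im = (z n).im := by simp [hnum, -Complex.ofReal_add]
    rw [h3, h4] at h2
    rw [one_mul]
    exact h2.trans (le_abs_self _)
  have hdenn : Tendsto (fun n : ℕ => ‖den n‖ / n) atTop (𝓝 (2 * ν)) := by
    have h1 := hden.norm
    rw [Complex.norm_real, add_zero, Real.norm_eq_abs, abs_of_pos (by positivity)] at h1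
    refine h1.congr fun n => ?_
    rw [norm_div, Complex.norm_natCast]
  have hexp : ∀ᶠ n : ℕ in atTop, ‖num n‖ / ‖den n‖ = Real.exp (ℓ * (z n).im) :=
    hbr.mono fun n hn => by rw [← norm_div]; exact hn.norm_div_eq
  -- Bootstrap: the numerator is `O(log n)` and the denominator grows like `2νn`, so `e^{ℓ Im z}`
  -- tends to zero.
  have himbot : Tendsto (fun n => ℓ * (z n).im) atTop atBot := by
    rw [← Real.tendsto_exp_comp_nhds_zero]
    have h1 := (hnumO.norm_left.trans_isLittleO hlogo).tendsto_div_nhds_zero.div hdenn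
      (by positivity : 2 * ν ≠ 0)
    rw [zero_div] at h1
    refine h1.congr' ?_
    filter_upwards [hexp, eventually_gt_atTop 0] with n hn hn0
    have hn0' : (n : ℝ) ≠ 0 := by exact_mod_cast hn0.ne'
    rw [← hn, Pi.div_apply, div_div_div_cancel_right₀ hn0']
  have himbot' : Tendsto (fun n => (z n).im) atTop atBot :=
    (tendsto_const_mul_atBot_of_pos hℓ).1 himbot
  have hnum1 : ∀ᶠ n in atTop, 1 ≤ ‖num n‖ := by
    filter_upwards [himbot'.eventually_le_atBot (-1)] with n hn
    have h4 : (num n).im = (z n).im := by simp [hnum, -Complex.ofReal_add]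
    have h5 := Complex.abs_im_le_norm (num n)
    rw [h4] at h5
    linarith [neg_abs_le (z n).im]
  -- As `Im z` tends to `-∞`, the numerator eventually has modulus at least `1`; its logarithm lies
  -- between `0` and `log log n` plus a constant. Only the denominator contributes at order `log n`.
  have hlognum : Tendsto (fun n : ℕ => Real.log ‖num n‖ / Real.log n) atTop (𝓝 0) := by
    obtain ⟨C, hC, hCb⟩ := hnumO.exists_pos
    have h1 : Tendsto (fun n : ℕ => (Real.log C + Real.log (Real.log n)) / Real.log n) atTop
        (𝓝 0) := by
      have h2 : (fun n : ℕ => Real.log C + Real.log (Real.log n)) =o[atTop]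
          fun n : ℕ => Real.log n :=
        ((Asymptotics.isLittleO_const_left).2 (Or.inr
          (tendsto_norm_atTop_atTop.comp tendsto_log_natCast))).add
          (Real.isLittleO_log_id_atTop.comp_tendsto tendsto_log_natCast)
      exact h2.tendsto_div_nhds_zero
    refine tendsto_of_tendsto_of_tendsto_of_le_of_le' tendsto_const_nhds h1 ?_ ?_
    · filter_upwards [hnum1, tendsto_log_natCast.eventually_gt_atTop 0] with n hn hl
      exact div_nonneg (Real.log_nonneg hn) hl.le
    · filter_upwards [hnum1, tendsto_log_natCast.eventually_gt_atTop 0, hCb.bound] with n hn hl hb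
      refine div_le_div_of_nonneg_right ?_ hl.le
      rw [← Real.log_mul hC.ne' hl.ne']
      rw [Real.norm_eq_abs, abs_of_pos hl] at hb
      exact Real.log_le_log (by linarith) hb
  have hlogden : Tendsto (fun n : ℕ => Real.log (‖den n‖ / n) / Real.log n) atTop (𝓝 0) :=
    ((Real.continuousAt_log (by positivity)).tendsto.comp hdenn).div_atTop tendsto_log_natCast
  have hfin := ((hlognum.sub hlogden).sub_const 1).const_mul ℓ⁻¹
  have e : ℓ⁻¹ * ((0 : ℝ) - 0 - 1) = -1 / ℓ := by ring
  rw [e] at hfin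
  refine hfin.congr' ?_
  filter_upwards [hexp, hbr, hnum1, tendsto_log_natCast.eventually_gt_atTop 0,
    eventually_gt_atTop 0] with n hn hb h1 hl hn0
  have hn0' : (n : ℝ) ≠ 0 := by exact_mod_cast hn0.ne'
  have hd0 : ‖den n‖ ≠ 0 := norm_ne_zero_iff.2 hb.add_ne_zero
  have h2 := congrArg Real.log hn
  rw [Real.log_div (by linarith) hd0, Real.log_exp] at h2
  change _ = (z n).im / Real.log n
  rw [Real.log_div hd0 hn0']
  field_simp
  linarith

/-- The general statement with scale `log n`, `D = β`, `D' = 0` and `Z = -1/ℓ`; the reflection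
`arccos(-t) = π - arccos t` produces the argument of `β + i/ℓ`. -/
lemma asymptotics_log (h : IsCharBranches ℓ θ) (hℓ : 0 < ℓ) (β : ℝ) :
    Tendsto (fun n : ℕ => (θ n (n * (Real.pi / ℓ) + β * Real.log n)).re - n * (Real.pi / ℓ))
        atTop (𝓝 (Real.pi / ℓ *
          (1 - Complex.arg ((β : ℂ) + Complex.I / (ℓ : ℂ)) / Real.pi))) ∧
      Asymptotics.IsEquivalent atTop
        (fun n : ℕ => -(θ n (n * (Real.pi / ℓ) + β * Real.log n)).im)
        (fun n : ℕ => Real.log n / ℓ) := by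
  have hnat : Tendsto (fun n : ℕ => (n : ℝ)) atTop atTop := tendsto_natCast_atTop_atTop
  have hlogo : (fun n : ℕ => Real.log n) =o[atTop] fun n : ℕ => (n : ℝ) :=
    Real.isLittleO_log_id_atTop.comp_tendsto hnat
  have hν0 : 0 < Real.pi / ℓ := div_pos Real.pi_pos hℓ
  have hδn : Tendsto (fun n : ℕ => β * Real.log n / n) atTop (𝓝 0) := by
    simpa [mul_div_assoc] using hlogo.tendsto_div_nhds_zero.const_mul β
  have ha : ∀ᶠ n : ℕ in atTop, 0 < n * (Real.pi / ℓ) + β * Real.log n := by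
    filter_upwards [hδn.eventually_const_lt (show -(Real.pi / ℓ) < 0 by linarith),
      eventually_gt_atTop 0] with n hn hn0
    have hn0' : (0 : ℝ) < n := by exact_mod_cast hn0
    rw [lt_div_iff₀ hn0'] at hn
    linarith
  have hlog0 := tendsto_log_natCast.eventually_gt_atTop 0
  have hδp : Tendsto (fun n : ℕ => β * Real.log n / Real.log n) atTop (𝓝 β) :=
    tendsto_const_nhds.congr' (hlog0.mono fun n hn => (mul_div_cancel_right₀ _ hn.ne').symm)
  have hZ := h.tendsto_im_div_log hℓ β ha
  have hmain := h.asymptotics hℓ tendsto_log_natCast hδp hδn hZ (by linarith)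
    (Or.inr (div_ne_zero (by norm_num) hℓ.ne')) ha
  constructor
  · convert hmain.1 using 2
    have hw0 : (β : ℂ) + Complex.I / ℓ ≠ 0 := by
      intro h0
      have := congrArg Complex.im h0
      simp [hℓ.ne'] at this
    have him : 0 ≤ ((β : ℂ) + Complex.I / ℓ).im := by
      simp [hℓ.le]
    have hre : ((β : ℂ) + Complex.I / ℓ).re = β := by simp
    have hneg : (-β + ((-1 / ℓ : ℝ) : ℂ) * Complex.I : ℂ) = -((β : ℂ) + Complex.I / ℓ) := by
      push_cast; ring
    have hcos := Complex.cos_arg hw0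
    rw [hre] at hcos
    rw [hneg, norm_neg, neg_div, Real.arccos_neg, ← hcos,
      Real.arccos_cos (Complex.arg_nonneg_iff.2 him) (Complex.arg_le_pi _)]
    field_simp
  · refine (Asymptotics.isEquivalent_iff_tendsto_one ?_).2 ?_
    · exact hlog0.mono fun n hn => (div_pos hn hℓ).ne'
    · have := hZ.const_mul (-ℓ)
      rw [show -ℓ * (-1 / ℓ) = 1 by field_simp] at this
      refine this.congr' (hlog0.mono fun n hn => ?_)
      simp only [Pi.div_apply]
      field_simp

/-- The general statement with scale `n`, `D = D' = (γ - 1)ν` and `Z = 0`. The limit direction is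
real, so the arccosine is `0` or `π` according to the sign of `1 - γ`. -/
lemma asymptotics_proportional (h : IsCharBranches ℓ θ) (hℓ : 0 < ℓ) {γ : ℝ} (hγ : 0 < γ)
    (hγ1 : γ ≠ 1) :
    Tendsto (fun n : ℕ => -(θ n (γ * n * (Real.pi / ℓ))).im) atTop
        (𝓝 (1 / ℓ * Real.log |(1 + γ) / (1 - γ)|)) ∧
      Tendsto (fun n : ℕ => (θ n (γ * n * (Real.pi / ℓ))).re - n * (Real.pi / ℓ)) atTop
        (𝓝 (if γ < 1 then 0 else Real.pi / ℓ)) := by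
  have hnat : Tendsto (fun n : ℕ => (n : ℝ)) atTop atTop := tendsto_natCast_atTop_atTop
  have hlogo : (fun n : ℕ => Real.log n) =o[atTop] fun n : ℕ => (n : ℝ) :=
    Real.isLittleO_log_id_atTop.comp_tendsto hnat
  have hν0 : 0 < Real.pi / ℓ := div_pos Real.pi_pos hℓ
  set ν := Real.pi / ℓ with hν
  have hα : ∀ n : ℕ, γ * n * ν = n * ν + (γ - 1) * ν * n := fun n => by ring
  simp only [hα]
  have ha : ∀ᶠ n : ℕ in atTop, 0 < n * ν + (γ - 1) * ν * n := by
    filter_upwards [eventually_gt_atTop 0] with n hn0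
    have hn0' : (0 : ℝ) < n := by exact_mod_cast hn0
    rw [← hα]
    positivity
  have hδ : Tendsto (fun n : ℕ => (γ - 1) * ν * n / n) atTop (𝓝 ((γ - 1) * ν)) := by
    refine tendsto_const_nhds.congr' ?_
    filter_upwards [eventually_gt_atTop 0] with n hn0
    have hn0' : (n : ℝ) ≠ 0 := by exact_mod_cast hn0.ne'
    rw [mul_div_cancel_right₀ _ hn0']
  have hD0 : (γ - 1) * ν ≠ 0 := mul_ne_zero (sub_ne_zero.2 hγ1) hν0.ne'
  obtain ⟨h1, h2⟩ := h.asymptotics hℓ (p := fun n : ℕ => (n : ℝ)) (Z := 0) hnat hδ hδ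
    ((h.isBigO_im hℓ ha).trans_isLittleO hlogo).tendsto_div_nhds_zero
    (by rw [← hν]; nlinarith) (Or.inl hD0) ha
  have hnorm : ‖(-((γ - 1) * ν : ℝ) + ((0 : ℝ) : ℂ) * Complex.I : ℂ)‖ = |1 - γ| * ν := by
    rw [Complex.ofReal_zero, zero_mul, add_zero, norm_neg, Complex.norm_real, Real.norm_eq_abs,
      abs_mul, abs_of_pos hν0, abs_sub_comm]
  rw [hnorm] at h1 h2
  have hγ0 : 1 - γ ≠ 0 := sub_ne_zero.2 (Ne.symm hγ1)
  constructor
  · have h3 := h2.const_mul ℓ⁻¹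
    have e : ℓ⁻¹ * -Real.log (|1 - γ| * ν / (2 * (Real.pi / ℓ) + (γ - 1) * ν)) =
        1 / ℓ * Real.log |(1 + γ) / (1 - γ)| := by
      rw [← hν, show 2 * ν + (γ - 1) * ν = (1 + γ) * ν by ring, mul_div_mul_right _ _ hν0.ne',
        ← Real.log_inv, inv_div, abs_div, abs_of_pos (show 0 < 1 + γ by linarith), one_div]
    rw [e] at h3
    refine h3.congr' ?_
    filter_upwards [eventually_gt_atTop 0] with n hn0
    have hn0' : (n : ℝ) ≠ 0 := by exact_mod_cast hn0.ne'
    rw [div_self hn0', Real.log_one, sub_zero, inv_mul_cancel_left₀ hℓ.ne']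
  · convert h1 using 2
    rw [show -((γ - 1) * ν) = (1 - γ) * ν by ring, mul_div_mul_right _ _ hν0.ne']
    split_ifs with hlt
    · rw [abs_of_pos (by linarith), div_self hγ0, Real.arccos_one, zero_div]
    · have : 1 - γ < 0 := lt_of_le_of_ne (by linarith) hγ0
      rw [abs_of_neg this, div_neg, div_self hγ0, Real.arccos_neg_one]

/-- The general statement with scale `n^ρ`, `D = s`, `D' = 0`; here `Z = 0` because `log n =
o(n^ρ)`. The coefficient `1 - ρ` comes from `log(n / n^ρ)`. -/
lemma asymptotics_rpow (h : IsCharBranches ℓ θ) (hℓ : 0 < ℓ) {ρ : ℝ} (hρ : 0 < ρ) (hρ1 : ρ < 1)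
    {s : ℝ} (hs : s ≠ 0) :
    Asymptotics.IsEquivalent atTop
        (fun n : ℕ => -(θ n (n * (Real.pi / ℓ) + s * (n : ℝ) ^ ρ)).im)
        (fun n : ℕ => (1 - ρ) / ℓ * Real.log n) ∧
      Tendsto (fun n : ℕ => (θ n (n * (Real.pi / ℓ) + s * (n : ℝ) ^ ρ)).re - n * (Real.pi / ℓ))
        atTop (𝓝 (if s < 0 then 0 else Real.pi / ℓ)) := by
  have hnat : Tendsto (fun n : ℕ => (n : ℝ)) atTop atTop := tendsto_natCast_atTop_atTop
  have hν0 : 0 < Real.pi / ℓ := div_pos Real.pi_pos hℓ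
  set ν := Real.pi / ℓ with hν
  have hp : Tendsto (fun n : ℕ => (n : ℝ) ^ ρ) atTop atTop := (tendsto_rpow_atTop hρ).comp hnat
  have hlogo : (fun n : ℕ => Real.log n) =o[atTop] fun n : ℕ => (n : ℝ) ^ ρ :=
    (isLittleO_log_rpow_atTop hρ).comp_tendsto hnat
  have hδn : Tendsto (fun n : ℕ => s * (n : ℝ) ^ ρ / n) atTop (𝓝 0) := by
    have h1 := ((tendsto_rpow_neg_atTop (sub_pos.2 hρ1)).comp hnat).const_mul s
    rw [mul_zero] at h1
    refine h1.congr' ?_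
    filter_upwards [eventually_gt_atTop 0] with n hn0
    have hn0' : (0 : ℝ) < n := by exact_mod_cast hn0
    rw [Function.comp, neg_sub, Real.rpow_sub_one hn0'.ne', mul_div_assoc]
  have ha : ∀ᶠ n : ℕ in atTop, 0 < n * ν + s * (n : ℝ) ^ ρ := by
    filter_upwards [hδn.eventually_const_lt (show -ν < 0 by linarith),
      eventually_gt_atTop 0] with n hn hn0
    have hn0' : (0 : ℝ) < n := by exact_mod_cast hn0
    rw [lt_div_iff₀ hn0'] at hn
    linarith
  have hδp : Tendsto (fun n : ℕ => s * (n : ℝ) ^ ρ / (n : ℝ) ^ ρ) atTop (𝓝 s) :=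
    tendsto_const_nhds.congr'
      ((hp.eventually_gt_atTop 0).mono fun n hn => (mul_div_cancel_right₀ _ hn.ne').symm)
  obtain ⟨h1, h2⟩ := h.asymptotics hℓ (Z := 0) hp hδp hδn
    ((h.isBigO_im hℓ ha).trans_isLittleO hlogo).tendsto_div_nhds_zero
    (by linarith) (Or.inl hs) ha
  have hnorm : ‖(-s + ((0 : ℝ) : ℂ) * Complex.I : ℂ)‖ = |s| := by
    rw [Complex.ofReal_zero, zero_mul, add_zero, norm_neg, Complex.norm_real, Real.norm_eq_abs]
  rw [hnorm] at h1 h2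
  have hlog0 := tendsto_log_natCast.eventually_gt_atTop 0
  have hρ' : 0 < 1 - ρ := sub_pos.2 hρ1
  constructor
  · refine (Asymptotics.isEquivalent_iff_tendsto_one ?_).2 ?_
    · exact hlog0.mono fun n hn => (mul_pos (div_pos hρ' hℓ) hn).ne'
    · have h3 := ((h2.div_atTop (tendsto_log_natCast.const_mul_atTop hρ'))).add_const 1
      rw [zero_add] at h3
      refine h3.congr' ?_
      filter_upwards [hlog0, eventually_gt_atTop 0] with n hn hn0
      have hn0' : (0 : ℝ) < n := by exact_mod_cast hn0
      rw [Real.log_div hn0'.ne' (Real.rpow_pos_of_pos hn0' _).ne', Real.log_rpow hn0']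
      simp only [Pi.div_apply, ← hν]
      generalize (θ n (n * ν + s * (n : ℝ) ^ ρ)).im = y
      field_simp
      ring
  · convert h1 using 2
    split_ifs with hlt
    · rw [abs_of_neg hlt, div_self (neg_ne_zero.2 hs), Real.arccos_one, zero_div]
    · have : 0 < s := lt_of_le_of_ne (not_lt.1 hlt) (Ne.symm hs)
      rw [abs_of_pos this, neg_div, div_self hs, Real.arccos_neg_one]

end IsCharBranches

theorem propositionB1 (ℓ : ℝ) (hℓ : 0 < ℓ) :
    ∃ θ : ℕ → ℝ → ℂ,
      -- the functions `θ n` exist and are unique on `[0, +∞[`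
      IsEigenBranches ℓ θ ∧
      (∀ θ' : ℕ → ℝ → ℂ, IsEigenBranches ℓ θ' → ∀ n, EqOn (θ' n) (θ n) (Ici 0)) ∧
      -- their squares are the eigenvalues, each one listed once
      (∀ α : ℝ, 0 ≤ α → {μ : ℂ | IsEigenvalueT ℓ α μ} = range (fun n => θ n α ^ 2) ∧
        Function.Injective (fun n => θ n α ^ 2)) ∧
      -- the characteristic equation
      (∀ n, ∀ α : ℝ, 0 ≤ α →
        ((α : ℂ) - θ n α) ^ 2 * Complex.exp (2 * Complex.I * ℓ * θ n α) =
          ((α : ℂ) + θ n α) ^ 2) ∧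
      -- (i)
      (∀ n : ℕ, StrictMonoOn (fun α => (θ n α).re) (Ici 0) ∧
        (θ n 0).re = n * (Real.pi / ℓ) ∧
        Tendsto (fun α => (θ n α).re) atTop (𝓝 ((n + 1) * (Real.pi / ℓ)))) ∧
      -- (ii)
      (∀ n : ℕ, Tendsto (fun α => (θ n α).im) atTop (𝓝 0)) ∧
      -- (iii)
      ((∀ n : ℕ, BddAbove ((fun α => |(θ n α).im|) '' Ici 0)) ∧
        (fun n : ℕ => sSup ((fun α => |(θ n α).im|) '' Ici 0)) =O[atTop]
          fun n : ℕ => Real.log n) ∧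
      -- (iv)
      (∀ β : ℝ,
        Tendsto (fun n : ℕ => (θ n (n * (Real.pi / ℓ) + β * Real.log n)).re - n * (Real.pi / ℓ))
          atTop (𝓝 (Real.pi / ℓ *
            (1 - Complex.arg ((β : ℂ) + Complex.I / (ℓ : ℂ)) / Real.pi))) ∧
        Asymptotics.IsEquivalent atTop
          (fun n : ℕ => -(θ n (n * (Real.pi / ℓ) + β * Real.log n)).im)
          (fun n : ℕ => Real.log n / ℓ)) ∧
      -- (v)
      (∀ γ : ℝ, 0 < γ → γ ≠ 1 →
        Tendsto (fun n : ℕ => -(θ n (γ * n * (Real.pi / ℓ))).im) atTop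
          (𝓝 (1 / ℓ * Real.log |(1 + γ) / (1 - γ)|)) ∧
        Tendsto (fun n : ℕ => (θ n (γ * n * (Real.pi / ℓ))).re - n * (Real.pi / ℓ)) atTop
          (𝓝 (if γ < 1 then 0 else Real.pi / ℓ))) ∧
      -- (vi)
      (∀ ρ : ℝ, 0 < ρ → ρ < 1 → ∀ s : ℝ, s ≠ 0 →
        Asymptotics.IsEquivalent atTop
          (fun n : ℕ => -(θ n (n * (Real.pi / ℓ) + s * (n : ℝ) ^ ρ)).im)
          (fun n : ℕ => (1 - ρ) / ℓ * Real.log n) ∧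
        Tendsto (fun n : ℕ => (θ n (n * (Real.pi / ℓ) + s * (n : ℝ) ^ ρ)).re - n * (Real.pi / ℓ))
          atTop (𝓝 (if s < 0 then 0 else Real.pi / ℓ))) := by
  choose θ hcont hzero hbr hmono hlim using exists_branch hℓ
  have h : IsCharBranches ℓ θ := ⟨hcont, hzero, hbr⟩
  refine ⟨θ, h.isEigenBranches hℓ, fun θ' h' n => h.eqOn hℓ h' n,
    fun α hα => ⟨h.setOf_isEigenvalueT hℓ hα, h.injective_sq hℓ hα⟩,
    fun n α hα => h.isCharRoot hℓ n hα,
    fun n => ⟨hmono n, by rw [hzero, Complex.ofReal_re], hlim n⟩,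
    fun n => h.tendsto_im hℓ n (hlim n),
    ⟨fun n => h.bddAbove_abs_im hℓ n, h.isBigO_sSup_abs_im hℓ⟩,
    fun β => h.asymptotics_log hℓ β,
    fun γ hγ hγ1 => h.asymptotics_proportional hℓ hγ hγ1,
    fun ρ hρ hρ1 s hs => h.asymptotics_rpow hℓ hρ hρ1 hs⟩
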